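/- Let $G$ be a finite group, let $G\mathcal F$ be (a small model of) the category of finite $G$-sets and $G$-maps, let $\mathcal U$ be the category of compactly generated spaces, and let $G\mathcal U$ be the category of $G$-objects in $\mathcal U$. A $\mathcal G$-space is a functor $\mathcal X\colon G\mathcal F^{op}\to\mathcal U$ that transforms finite disjoint unions into products; $\mathcal G\mathcal U$ denotes the category of $\mathcal G$-spaces and natural transformations. A map $\mathcal X\to\mathcal Y$ of $\mathcal G$-spaces is a weak equivalence if $\mathcal X(S)\to\mathcal Y(S)$ is a weak homotopy equivalence for every finite $G$-set $S$. Let $\Phi\colon G\mathcal U\to\mathcal G\mathcal U$ be the fixed point functor, $\Phi X(S)=\mathrm{Map}_{G\mathcal U}(S,X)$; a map $f$ of $G$-spaces is a weak equivalence if $\Phi f$ is one. Let $J\colon G\mathcal F\to G\mathcal U$ be the inclusion, and let $\Psi\colon\mathcal G\mathcal U\to G\mathcal U$ be the functor $\Psi\mathcal X=B(\mathcal X,G\mathcal F,J)=|B_\bullet(\mathcal X,G\mathcal F,J)|$, where the space of $n$-simplices of the simplicial $G$-space $B_\bullet(\mathcal X,G\mathcal F,J)$ is $$\{(x,\underline f,\alpha)\mid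 x\in\mathcal X(S_0),\ \underline f=(S_0\xleftarrow{f_1}S_1\xleftarrow{f_2}\cdots\xleftarrow{f_n}S_n)\text{ a chain of maps in }G\mathcal F,\ \alpha\in S_n\},$$ topologized as the disjoint union of the spaces $\mathcal X(S_0)$ over all $(\underline f,\alpha)$, with the usual face maps (by composition, and by functoriality of $\mathcal X$ and $J$) and degeneracy maps (by insertion of identities), and with $G$ acting on $\alpha$. Then there is a natural transformation $\varepsilon\colon\Phi\Psi\to\mathrm{id}_{\mathcal G\mathcal U}$ such that for each $\mathcal X\in\mathcal G\mathcal U$ the map $\varepsilon_{\mathcal X}\colon\Phi\Psi\mathcal X\to\mathcal X$ is a weak equivalence of $\mathcal G$-spaces and, moreover, for each orbit $S$ (a nonempty transitive finite $G$-set, i.e. $S\cong G/H$ for some subgroup $H\le G$), $\varepsilon_{\mathcal X}(S)\colon\Phi\Psi\mathcal X(S)\to\mathcal X(S)$ is a strong deformation retraction: it has a section $i$ such that $i\circ\varepsilon_{\mathcal X}(S)$ is homotopic to the identity relative to the image of $i$. Consequently, $\Psi$ sends weak equivalences of $\mathcal G$-spaces to weak equivalences of $G$-spaces. -/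

import Mathlib

open CategoryTheory CategoryTheory.Limits Opposite Topology

universe u v

/-! ### Finite `G`-sets -/

/-- Finite `G`-sets. The bar construction is indexed by all chains of maps of finite `G`-sets, so
a small model of this category is used: the underlying set is `Fin n` for some `n`. Every finite
`G`-set is isomorphic to one of these, see `FinGSet.exists_equiv`. -/
structure FinGSet (G : Type u) [Group G] : Type u where
  /-- the number of elements -/
  card : ℕ
  /-- the action -/
  [action : MulAction G (Fin card)]

namespace FinGSet

variable {G : Type u} [Group G]

instance : CoeSort (FinGSet G) Type := ⟨fun S => Fin S.card⟩

instance (S : FinGSet G) : MulAction G S := S.action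

/-- Morphisms of finite `G`-sets are the `G`-equivariant maps. -/
instance : Category.{0} (FinGSet G) where
  Hom S T := S →[G] T
  id S := MulActionHom.id G
  comp f g := g.comp f

instance (S T : FinGSet G) : FunLike (S ⟶ T) S T :=
  inferInstanceAs (FunLike (S →[G] T) S T)

theorem map_smul' {S T : FinGSet G} (f : S ⟶ T) (g : G) (s : S) : f (g • s) = g • f s :=
  MulActionHom.map_smul (f : S →[G] T) g s

theorem hom_ext' {S T : FinGSet G} {f f' : S ⟶ T} (h : ∀ s, f s = f' s) : f = f' :=
  MulActionHom.ext (f := (f : S →[G] T)) (g := f') h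

theorem id_apply (S : FinGSet G) (s : S) : (𝟙 S : S ⟶ S) s = s := rfl

theorem comp_apply {R S T : FinGSet G} (f : R ⟶ S) (g : S ⟶ T) (r : R) :
    (f ≫ g) r = g (f r) := rfl

/-- Every finite `G`-set is isomorphic to an object of `FinGSet G`. -/
theorem exists_equiv (A : Type v) [Finite A] [MulAction G A] :
    ∃ (S : FinGSet G) (e : S ≃ A), ∀ (g : G) (s : S), e (g • s) = g • e s := by
  obtain ⟨n, ⟨e⟩⟩ := Finite.exists_equiv_fin A
  let _ : MulAction G (Fin n) :=
    { smul := fun g s => e (g • e.symm s)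
      one_smul := fun s => by
        change e ((1 : G) • e.symm s) = s
        simp
      mul_smul := fun g h s => by
        change e ((g * h) • e.symm s) = e (g • e.symm (e (h • e.symm s)))
        simp [mul_smul] }
  refine ⟨⟨n⟩, e.symm, fun g s => ?_⟩
  change e.symm (e (g • e.symm s)) = _
  simp

/-- A coproduct cofan in the category of finite `G`-sets is a disjoint union decomposition. -/
theorem cofan_bijective {n : ℕ} {K : Discrete (Fin n) ⥤ (FinGSet G)ᵒᵖ} {c : Cone K}
    (hc : IsLimit c) :
    Function.Bijective (β := c.pt.unop)
      (fun p : (Σ i : Fin n, ((K.obj ⟨i⟩).unop : Type)) => (c.π.app ⟨p.1⟩).unop p.2) := by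
  let _ : MulAction G (Σ i : Fin n, ((K.obj ⟨i⟩).unop : Type)) :=
    { smul := fun g p => ⟨p.1, g • p.2⟩
      one_smul := fun p => by
        change (⟨p.1, (1 : G) • p.2⟩ : Σ i : Fin n, ((K.obj ⟨i⟩).unop : Type)) = p
        rw [one_smul]
      mul_smul := fun g h p => by
        change (⟨p.1, (g * h) • p.2⟩ : Σ i : Fin n, ((K.obj ⟨i⟩).unop : Type)) =
          ⟨p.1, g • h • p.2⟩
        rw [mul_smul] }
  obtain ⟨P, e, he⟩ := exists_equiv (G := G) (Σ i : Fin n, ((K.obj ⟨i⟩).unop : Type))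
  have he' : ∀ (g : G) p, e.symm (g • p) = g • e.symm p := fun g p => by
    rw [Equiv.symm_apply_eq, he, e.apply_symm_apply]
    rfl
  let ι (j : Discrete (Fin n)) : (K.obj j).unop ⟶ P :=
    { toFun := fun s => e.symm ⟨j.as, s⟩
      map_smul' := fun g s => he' g ⟨j.as, s⟩ }
  let s : Cone K :=
    { pt := op P
      π := Discrete.natTrans fun j => (ι j).op }
  have hl : ∀ j x, (hc.lift s).unop ((c.π.app j).unop x) = e.symm ⟨j.as, x⟩ := fun j x => by
    have h := congrArg Quiver.Hom.unop (hc.fac s j)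
    rw [unop_comp] at h
    exact DFunLike.congr_fun (F := (K.obj j).unop ⟶ P) h x
  let d : P ⟶ c.pt.unop :=
    { toFun := fun p => (c.π.app ⟨(e p).1⟩).unop (e p).2
      map_smul' := fun g p => by
        rw [he]
        exact FinGSet.map_smul' _ g _ }
  have hd : (hc.lift s).unop ≫ d = 𝟙 c.pt.unop := by
    apply Quiver.Hom.op_inj
    apply hc.hom_ext
    intro j
    apply Quiver.Hom.unop_inj
    apply hom_ext'
    intro x
    change d ((hc.lift s).unop ((c.π.app j).unop x)) = (c.π.app j).unop x
    rw [hl]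
    change (c.π.app ⟨(e (e.symm ⟨j.as, x⟩)).1⟩).unop (e (e.symm ⟨j.as, x⟩)).2 = _
    rw [e.apply_symm_apply]
  constructor
  · intro p q h
    have h' := congrArg (hc.lift s).unop h
    rw [hl, hl] at h'
    exact e.symm.injective h'
  · intro t
    refine ⟨e ((hc.lift s).unop t), ?_⟩
    exact DFunLike.congr_fun (F := c.pt.unop ⟶ c.pt.unop) hd t

end FinGSet

/-! ### Compactly generated spaces -/

/-- The set `X` with the compactly generated topology associated to a given topology, i.e. the
finest topology for which all continuous maps from compact Hausdorff spaces to `X` remain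
continuous. -/
@[ext]
structure Kify (X : Type u) : Type u where
  /-- the underlying point of `X` -/
  val : X

namespace Kify

variable {X : Type u} [TopologicalSpace X]

instance : TopologicalSpace (Kify X) :=
  (TopologicalSpace.compactlyGenerated.{u} X).coinduced Kify.mk

theorem continuous_from {Y : Type v} [TopologicalSpace Y] (f : Kify X → Y)
    (h : ∀ (S : CompHaus.{u}) (g : C(S, X)), Continuous fun s => f ⟨g s⟩) : Continuous f :=
  continuous_coinduced_dom.2 (continuous_from_compactlyGenerated.{u} (fun x => f ⟨x⟩) h)

theorem continuous_val : Continuous (Kify.val : Kify X → X) :=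
  continuous_from _ fun _ g => g.continuous

theorem continuous_test (K : CompHaus.{u}) (g : C(K, X)) :
    Continuous (fun k => (⟨g k⟩ : Kify X)) := by
  have h : Continuous[_, TopologicalSpace.compactlyGenerated.{u} X]
      (fun a : (Σ (i : (S : CompHaus.{u}) × C(S, X)), i.fst) => a.1.2 a.2) :=
    continuous_coinduced_rng
  have h' : Continuous[TopologicalSpace.compactlyGenerated.{u} X, _] (Kify.mk : X → Kify X) :=
    continuous_coinduced_rng
  exact @Continuous.comp _ _ _ _ (TopologicalSpace.compactlyGenerated.{u} X) _ _ _ h'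
    ((@continuous_sigma_iff _ _ _ _ (TopologicalSpace.compactlyGenerated.{u} X) _).1 h ⟨K, g⟩)

instance : UCompactlyGeneratedSpace.{u} (Kify X) :=
  uCompactlyGeneratedSpace_of_continuous_maps fun f h =>
    continuous_from f fun S g => h S ⟨_, continuous_test S g⟩

/-- A continuous map from a compactly generated space to `X` is continuous into `Kify X`. -/
theorem continuous_mk {Y : Type u} [TopologicalSpace Y] [UCompactlyGeneratedSpace.{u} Y]
    {f : Y → X} (hf : Continuous f) : Continuous (fun y => (⟨f y⟩ : Kify X)) :=
  continuous_from_uCompactlyGeneratedSpace.{u} _ fun S g =>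
    continuous_test S ⟨_, hf.comp g.continuous⟩

end Kify

/-- The product of a compactly generated space and a compact Hausdorff space is compactly
generated, so that it is also the product in the category of compactly generated spaces. -/
instance uCompactlyGeneratedSpace_prod_compact (X : Type u) [TopologicalSpace X]
    [UCompactlyGeneratedSpace.{u} X] (K : Type) [TopologicalSpace K] [CompactSpace K] [T2Space K] :
    UCompactlyGeneratedSpace.{u} (X × K) := by
  refine uCompactlyGeneratedSpace_of_continuous_maps fun {Z} _ f h => ?_
  have h1 : ∀ x, Continuous fun k => f (x, k) := fun x => by
    have := h (CompHaus.of (ULift.{u} K))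
      ⟨fun k => (x, k.down), continuous_const.prodMk continuous_uliftDown⟩
    exact this.comp continuous_uliftUp
  have h2 : Continuous fun x => (⟨fun k => f (x, k), h1 x⟩ : C(K, Z)) := by
    refine continuous_from_uCompactlyGeneratedSpace.{u} _ fun S g => ?_
    refine ContinuousMap.continuous_of_continuous_uncurry _ ?_
    exact h (CompHaus.of (S × K)) ⟨fun p => (g p.1, p.2), by fun_prop⟩
  exact ContinuousMap.continuous_uncurry_of_continuous ⟨_, h2⟩

/-! ### Geometric realization -/

/-- The disjoint union of the spaces `Yₙ × Δⁿ`. -/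
abbrev SimplicialSpace.Total (Y : SimplicialObject CompactlyGenerated.{u, u}) : Type u :=
  Σ n : SimplexCategory, (Y.obj (op n) : Type u) × stdSimplex ℝ (Fin (n.len + 1))

/-- The relation `(θ^* y, t) ~ (y, θ_* t)` for `θ : [m] → [n]`, `y ∈ Yₙ` and `t ∈ Δᵐ`. -/
inductive SimplicialSpace.Rel (Y : SimplicialObject CompactlyGenerated.{u, u}) :
    SimplicialSpace.Total Y → SimplicialSpace.Total Y → Prop
  | glue {m n : SimplexCategory} (θ : m ⟶ n) (y : (Y.obj (op n) : Type u))
      (t : stdSimplex ℝ (Fin (m.len + 1))) :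
      SimplicialSpace.Rel Y ⟨m, (Y.map θ.op y, t)⟩ ⟨n, (y, stdSimplex.map θ t)⟩

/-- The underlying space of the geometric realization. -/
abbrev SimplicialSpace.Realization (Y : SimplicialObject CompactlyGenerated.{u, u}) : Type u :=
  Quot (SimplicialSpace.Rel Y)

instance (Y : SimplicialObject CompactlyGenerated.{u, u}) :
    UCompactlyGeneratedSpace.{u} (SimplicialSpace.Realization Y) :=
  uCompactlyGeneratedSpace_of_coinduced continuous_quot_mk rfl

/-- The map of geometric realizations induced by a map of simplicial spaces. -/
def SimplicialSpace.realizationMap {Y Z : SimplicialObject CompactlyGenerated.{u, u}}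
    (f : Y ⟶ Z) : C(SimplicialSpace.Realization Y, SimplicialSpace.Realization Z) where
  toFun := Quot.map (fun p => ⟨p.1, (f.app (op p.1) p.2.1, p.2.2)⟩) (by
    rintro _ _ ⟨θ, y, t⟩
    have h : f.app _ (Y.map θ.op y) = Z.map θ.op (f.app _ y) :=
      ConcreteCategory.congr_hom (f.naturality θ.op) y
    dsimp only
    rw [h]
    exact .glue θ _ t)
  continuous_toFun := by
    refine continuous_quot_lift _ ?_
    refine Continuous.comp (g := Quot.mk _) continuous_quot_mk ?_
    refine continuous_sigma fun n => continuous_sigmaMk.comp ?_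
    exact ((f.app (op n)).hom.hom.continuous.comp continuous_fst).prodMk continuous_snd

/-- Geometric realization of simplicial compactly generated spaces. -/
def geometricRealization :
    SimplicialObject CompactlyGenerated.{u, u} ⥤ CompactlyGenerated.{u, u} where
  obj Y := CompactlyGenerated.of (SimplicialSpace.Realization Y)
  map f := CompactlyGenerated.ofHom (SimplicialSpace.realizationMap f)
  map_id Y := by
    ext x
    induction x using Quot.ind
    rfl
  map_comp f g := by
    ext x
    induction x using Quot.ind
    rfl

/-! ### `G`-spaces and systems of spaces over finite `G`-sets -/

/-- `G`-spaces: compactly generated spaces with an action of the (finite, discrete) group `G`. -/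
abbrev GSpace (G : Type u) [Group G] := Action CompactlyGenerated.{u, u} G

/-- The action of `g : G` on the `G`-space `X`. -/
abbrev GSpace.act {G : Type u} [Group G] (X : GSpace G) (g : G) : X.V ⟶ X.V := X.ρ g

/-- A contravariant functor from finite `G`-sets to compactly generated spaces is a system of
spaces if it transforms finite disjoint unions into products. -/
abbrev isGSystem (G : Type u) [Group G] :
    ObjectProperty ((FinGSet G)ᵒᵖ ⥤ CompactlyGenerated.{u, u}) :=
  fun F => PreservesFiniteProducts F

/-- The category of systems of spaces over the finite `G`-sets. -/
abbrev GSystem (G : Type u) [Group G] := (isGSystem G).FullSubcategory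

/-- The set of equivariant maps from a finite `G`-set to a `G`-space, as a subspace of the space of
all maps `S → X` (which has the product topology as `S` is finite and discrete). -/
abbrev EquivariantMap {G : Type u} [Group G] (S : FinGSet G) (X : GSpace G) : Type u :=
  {f : S → (X.V : Type u) // ∀ (g : G) (s : S), f (g • s) = X.act g (f s)}

namespace EquivariantMap

variable {G : Type u} [Group G]

/-- The map `Map_G(T, X) → Map_G(S, Y)` induced by `h : S → T` and `k : X → Y`. -/
def map {S T : FinGSet G} {X Y : GSpace G} (h : S ⟶ T) (k : X ⟶ Y) :
    C(Kify (EquivariantMap T X), Kify (EquivariantMap S Y)) where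
  toFun f := ⟨⟨fun s => k.hom (f.val.1 (h s)), fun g s => by
    change k.hom (f.val.1 (h (g • s))) = Y.act g (k.hom (f.val.1 (h s)))
    rw [FinGSet.map_smul', f.val.2]
    exact ConcreteCategory.congr_hom (k.comm g) _⟩⟩
  continuous_toFun := by
    refine Kify.continuous_mk (Continuous.subtype_mk (continuous_pi fun s => ?_) _)
    exact k.hom.hom.hom.continuous.comp
      ((continuous_apply (h s)).comp (continuous_subtype_val.comp Kify.continuous_val))

/-- Evaluation of an equivariant map. -/
abbrev eval {S : FinGSet G} {X : GSpace G} (f : Kify (EquivariantMap S X)) (s : S) : X.V :=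
  f.val.1 s

end EquivariantMap

/-- The functor `S ↦ Map_G(S, X)`. -/
def fixedPointFunctor {G : Type u} [Group G] (X : GSpace G) :
    (FinGSet G)ᵒᵖ ⥤ CompactlyGenerated.{u, u} where
  obj S := CompactlyGenerated.of (Kify (EquivariantMap S.unop X))
  map h := CompactlyGenerated.ofHom (EquivariantMap.map h.unop (𝟙 X))
  map_id _ := rfl
  map_comp _ _ := rfl

theorem fixedPointFunctor_isGSystem {G : Type u} [Group G] (X : GSpace G) :
    isGSystem G (fixedPointFunctor X) := by
  refine ⟨fun n => ⟨fun {K} => ⟨fun {c} hc => ⟨?_⟩⟩⟩⟩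
  have hb := FinGSet.cofan_bijective hc
  let e := Equiv.ofBijective _ hb
  have hlift : ∀ (t : Cone (K ⋙ fixedPointFunctor X)), ∃ l : t.pt ⟶ (fixedPointFunctor X).obj c.pt,
      ∀ (j : Discrete (Fin n)) (y : (t.pt : Type u)) (s : (K.obj j).unop),
        EquivariantMap.eval (l y) ((c.π.app j).unop s) = EquivariantMap.eval (t.π.app j y) s := by
    intro t
    let v (y : (t.pt : Type u)) (p : Σ i : Fin n, ((K.obj ⟨i⟩).unop : Type)) : (X.V : Type u) :=
      EquivariantMap.eval (t.π.app ⟨p.1⟩ y) p.2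
    have hv : ∀ y, ∀ (g : G) s, v y (e.symm (g • s)) = X.act g (v y (e.symm s)) := fun y g s => by
      obtain ⟨⟨i, s⟩, rfl⟩ := e.surjective s
      have h : g • e ⟨i, s⟩ = e ⟨i, g • s⟩ := (FinGSet.map_smul' _ g s).symm
      rw [h, e.symm_apply_apply, e.symm_apply_apply]
      exact (t.π.app ⟨i⟩ y).val.2 g s
    refine ⟨CompactlyGenerated.ofHom ⟨fun y => ⟨⟨fun s => v y (e.symm s), hv y⟩⟩, ?_⟩, ?_⟩
    · refine Kify.continuous_mk (Continuous.subtype_mk (continuous_pi fun s => ?_) _)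
      exact (continuous_apply (e.symm s).2).comp (continuous_subtype_val.comp
        (Kify.continuous_val.comp (t.π.app ⟨(e.symm s).1⟩).hom.hom.continuous))
    · intro j y s
      exact congrArg (v y) (e.symm_apply_apply ⟨j.as, s⟩)
  choose l hl using hlift
  exact
    { lift := l
      fac := fun t j => by
        ext y
        refine Kify.ext (Subtype.ext (funext fun s => hl t j y s))
      uniq := fun t m hm => by
        ext y
        refine Kify.ext (Subtype.ext (funext fun s => ?_))
        obtain ⟨⟨i, s⟩, rfl⟩ := hb.2 s
        refine Eq.trans ?_ (hl t ⟨i⟩ y s).symm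
        rw [← hm]
        rfl }

/-- The fixed point functor `Φ`, from `G`-spaces to systems of spaces. -/
def Phi (G : Type u) [Group G] : GSpace G ⥤ GSystem G where
  obj X := ⟨fixedPointFunctor X, fixedPointFunctor_isGSystem X⟩
  map {X Y} k := ObjectProperty.homMk
    { app := fun S => CompactlyGenerated.ofHom (EquivariantMap.map (𝟙 S.unop) k)
      naturality := fun S T h => by
        ext f
        refine Kify.ext (Subtype.ext (funext fun s => ?_))
        rfl }
  map_id _ := rfl
  map_comp _ _ := rfl

/-! ### The bar construction -/

section Bar

variable {G : Type u} [Group G]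

/-- The space of `n`-simplices of the bar construction `B_•(𝒳, G𝓕, J)`. An object `c` of
`ComposableArrows (FinGSet G)ᵒᵖ n` is a chain `S₀ ← S₁ ← ⋯ ← Sₙ` of maps of finite `G`-sets, with
`Sᵢ = (c.obj i).unop`, and the space of `n`-simplices is the disjoint union of the spaces `𝒳(S₀)`
over all such `c` and all `α ∈ Sₙ`. -/
abbrev BarSpace (X : (FinGSet G)ᵒᵖ ⥤ CompactlyGenerated.{u, u}) (n : SimplexCategory) : Type u :=
  Σ p : (Σ c : ComposableArrows (FinGSet G)ᵒᵖ n.len, ((c.obj (Fin.last n.len)).unop : Type)),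
    (X.obj (p.1.obj 0) : Type u)

theorem BarSpace.continuous_mk {X : (FinGSet G)ᵒᵖ ⥤ CompactlyGenerated.{u, u}}
    {n : SimplexCategory} (p : Σ c : ComposableArrows (FinGSet G)ᵒᵖ n.len,
      ((c.obj (Fin.last n.len)).unop : Type)) :
    Continuous (fun x : X.obj (p.1.obj 0) => (⟨p, x⟩ : BarSpace X n)) :=
  continuous_sigmaMk (σ := fun p : (Σ c : ComposableArrows (FinGSet G)ᵒᵖ n.len,
    ((c.obj (Fin.last n.len)).unop : Type)) => (X.obj (p.1.obj 0) : Type u)) (i := p)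

/-- The simplicial operator of `θ : [m] → [n]` sends `(x, S₀ ← ⋯ ← Sₙ, α)` to the chain
`S_{θ(0)} ← ⋯ ← S_{θ(m)}` with the image of `x` under `𝒳(S₀) → 𝒳(S_{θ(0)})` and the image of `α`
under `Sₙ → S_{θ(m)}`. -/
def barMap (X : (FinGSet G)ᵒᵖ ⥤ CompactlyGenerated.{u, u}) {m n : SimplexCategory} (θ : m ⟶ n) :
    C(BarSpace X n, BarSpace X m) where
  toFun b :=
    ⟨⟨b.1.1.whiskerLeft (SimplexCategory.toCat.map θ).toFunctor,
      (b.1.1.map (homOfLE (Fin.le_last (θ (Fin.last m.len))))).unop b.1.2⟩,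
      X.map (b.1.1.map (homOfLE (Fin.zero_le (θ 0)))) b.2⟩
  continuous_toFun := by
    refine continuous_sigma fun p => ?_
    exact (BarSpace.continuous_mk (X := X) (n := m)
      ⟨p.1.whiskerLeft (SimplexCategory.toCat.map θ).toFunctor,
        (p.1.map (homOfLE (Fin.le_last (θ (Fin.last m.len))))).unop p.2⟩).comp
      (X.map (p.1.map (homOfLE (Fin.zero_le (θ 0))))).hom.hom.continuous

theorem BarSpace.ext' {X : (FinGSet G)ᵒᵖ ⥤ CompactlyGenerated.{u, u}} {n : SimplexCategory}
    (c : ComposableArrows (FinGSet G)ᵒᵖ n.len) {α β : (c.obj (Fin.last n.len)).unop}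
    {x y : X.obj (c.obj 0)} (h : α = β) (h' : x = y) :
    (⟨⟨c, α⟩, x⟩ : BarSpace X n) = ⟨⟨c, β⟩, y⟩ := by
  subst h h'
  rfl

theorem barMap_id (X : (FinGSet G)ᵒᵖ ⥤ CompactlyGenerated.{u, u}) (n : SimplexCategory)
    (b : BarSpace X n) : barMap X (𝟙 n) b = b := by
  obtain ⟨⟨c, α⟩, x⟩ := b
  refine BarSpace.ext' c ?_ ?_
  · change (c.map (𝟙 (Fin.last n.len))).unop α = α
    rw [c.map_id]
    rfl
  · change X.map (c.map (𝟙 0)) x = x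
    rw [c.map_id, X.map_id]
    rfl

theorem barMap_comp (X : (FinGSet G)ᵒᵖ ⥤ CompactlyGenerated.{u, u}) {l m n : SimplexCategory}
    (η : l ⟶ m) (θ : m ⟶ n) (b : BarSpace X n) :
    barMap X (η ≫ θ) b = barMap X η (barMap X θ b) := by
  obtain ⟨⟨c, α⟩, x⟩ := b
  refine BarSpace.ext' (c.whiskerLeft (SimplexCategory.toCat.map (η ≫ θ)).toFunctor) ?_ ?_
  · have h : c.map (homOfLE (θ.toOrderHom.monotone (Fin.le_last (η (Fin.last l.len))))) ≫
        c.map (homOfLE (Fin.le_last (θ (Fin.last m.len)))) =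
        c.map (homOfLE (Fin.le_last (θ (η (Fin.last l.len))))) := by
      rw [← c.map_comp]
      rfl
    exact congrArg (fun f => f.unop α) h.symm
  · have h : X.map (c.map (homOfLE (Fin.zero_le (θ 0)))) ≫
        X.map (c.map (homOfLE (θ.toOrderHom.monotone (Fin.zero_le (η 0))))) =
        X.map (c.map (homOfLE (Fin.zero_le (θ (η 0))))) := by
      rw [← X.map_comp, ← c.map_comp]
      rfl
    exact ConcreteCategory.congr_hom h.symm x

/-- The simplicial space `B_•(𝒳, G𝓕, J)`. -/
def barSimplicial (X : (FinGSet G)ᵒᵖ ⥤ CompactlyGenerated.{u, u}) :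
    SimplicialObject CompactlyGenerated.{u, u} where
  obj n := CompactlyGenerated.of (BarSpace X n.unop)
  map θ := CompactlyGenerated.ofHom (barMap X θ.unop)
  map_id n := ConcreteCategory.hom_ext _ _ (barMap_id X n.unop)
  map_comp f g := ConcreteCategory.hom_ext _ _ (barMap_comp X g.unop f.unop)

/-- The action of `g` on `n`-simplices: `(x, f, α) ↦ (x, f, g • α)`. -/
def barSmul (X : (FinGSet G)ᵒᵖ ⥤ CompactlyGenerated.{u, u}) (g : G) (n : SimplexCategory) :
    C(BarSpace X n, BarSpace X n) where
  toFun b := ⟨⟨b.1.1, g • b.1.2⟩, b.2⟩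
  continuous_toFun := continuous_sigma fun p => BarSpace.continuous_mk ⟨p.1, g • p.2⟩

theorem barMap_smul (X : (FinGSet G)ᵒᵖ ⥤ CompactlyGenerated.{u, u}) (g : G)
    {m n : SimplexCategory} (θ : m ⟶ n) (b : BarSpace X n) :
    barSmul X g m (barMap X θ b) = barMap X θ (barSmul X g n b) :=
  BarSpace.ext' (b.1.1.whiskerLeft (SimplexCategory.toCat.map θ).toFunctor)
    (FinGSet.map_smul' (b.1.1.map (homOfLE (Fin.le_last (θ (Fin.last m.len))))).unop g b.1.2).symm
    rfl

/-- The action of `g` on `B_•(𝒳, G𝓕, J)`. -/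
def barAct (X : (FinGSet G)ᵒᵖ ⥤ CompactlyGenerated.{u, u}) (g : G) :
    barSimplicial X ⟶ barSimplicial X where
  app n := CompactlyGenerated.ofHom (barSmul X g n.unop)
  naturality _ _ θ := ConcreteCategory.hom_ext _ _ fun b => barMap_smul X g θ.unop b

/-- The simplicial `G`-space `B_•(𝒳, G𝓕, J)`. -/
def barAction (X : (FinGSet G)ᵒᵖ ⥤ CompactlyGenerated.{u, u}) :
    Action (SimplicialObject CompactlyGenerated.{u, u}) G where
  V := barSimplicial X
  ρ :=
    { toFun := barAct X
      map_one' := NatTrans.ext <| funext fun n => ConcreteCategory.hom_ext _ _ fun b =>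
        BarSpace.ext' (X := X) (n := n.unop) b.1.1 (one_smul G b.1.2) rfl
      map_mul' := fun g h => NatTrans.ext <| funext fun n => ConcreteCategory.hom_ext _ _ fun b =>
        BarSpace.ext' (X := X) (n := n.unop) b.1.1 (mul_smul g h b.1.2) rfl }

/-- The map on `n`-simplices induced by a map `𝒳 → 𝒴`. -/
def barPost {X Y : (FinGSet G)ᵒᵖ ⥤ CompactlyGenerated.{u, u}} (f : X ⟶ Y) (n : SimplexCategory) :
    C(BarSpace X n, BarSpace Y n) where
  toFun b := ⟨b.1, f.app (b.1.1.obj 0) b.2⟩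
  continuous_toFun := continuous_sigma fun p =>
    (BarSpace.continuous_mk (X := Y) p).comp (f.app (p.1.obj 0)).hom.hom.continuous

theorem barMap_post {X Y : (FinGSet G)ᵒᵖ ⥤ CompactlyGenerated.{u, u}} (f : X ⟶ Y)
    {m n : SimplexCategory} (θ : m ⟶ n) (b : BarSpace X n) :
    barPost f m (barMap X θ b) = barMap Y θ (barPost f n b) :=
  BarSpace.ext' (b.1.1.whiskerLeft (SimplexCategory.toCat.map θ).toFunctor) rfl
    (ConcreteCategory.congr_hom (f.naturality (b.1.1.map (homOfLE (Fin.zero_le (θ 0))))) b.2)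

/-- The map of simplicial spaces induced by a map `𝒳 → 𝒴`. -/
def barSimplicialMap {X Y : (FinGSet G)ᵒᵖ ⥤ CompactlyGenerated.{u, u}} (f : X ⟶ Y) :
    barSimplicial X ⟶ barSimplicial Y where
  app n := CompactlyGenerated.ofHom (barPost f n.unop)
  naturality _ _ θ := ConcreteCategory.hom_ext _ _ fun b => barMap_post f θ.unop b

/-- The functor `𝒳 ↦ B_•(𝒳, G𝓕, J)` from systems of spaces to simplicial `G`-spaces. -/
def barConstruction (G : Type u) [Group G] :
    GSystem G ⥤ Action (SimplicialObject CompactlyGenerated.{u, u}) G where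
  obj X := barAction X.obj
  map f :=
    { hom := barSimplicialMap f.hom
      comm := fun _ => rfl }
  map_id _ := rfl
  map_comp _ _ := rfl

/-- The functor `Ψ`, sending `𝒳` to the `G`-space `B(𝒳, G𝓕, J) = |B_•(𝒳, G𝓕, J)|`. -/
def Psi (G : Type u) [Group G] : GSystem G ⥤ GSpace G :=
  barConstruction G ⋙ geometricRealization.mapAction G

end Bar

/-! ### Weak equivalences -/

section Weak

variable {X : Type u} {Y : Type v} [TopologicalSpace X] [TopologicalSpace Y]

/-- The map on path components induced by a continuous map. -/
def ContinuousMap.mapZerothHomotopy (f : C(X, Y)) : ZerothHomotopy X → ZerothHomotopy Y :=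
  Quotient.map f fun _ _ h => h.map f.continuous

/-- The map on the `n`-th homotopy group (or set, for `n = 0`) induced by a continuous map. -/
def ContinuousMap.mapHomotopyGroup (f : C(X, Y)) (n : ℕ) (x : X) :
    HomotopyGroup (Fin n) X x → HomotopyGroup (Fin n) Y (f x) :=
  Quotient.map (fun p => ⟨f.comp p.1, fun y hy => congrArg f (p.2 y hy)⟩)
    fun _ _ h => h.comp_continuousMap f

/-- A weak homotopy equivalence: a map that induces a bijection on path components and an
isomorphism on all homotopy groups at all base points. -/
def ContinuousMap.IsWeakHomotopyEquiv (f : C(X, Y)) : Prop :=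
  Function.Bijective f.mapZerothHomotopy ∧
    ∀ (n : ℕ) (x : X), Function.Bijective (f.mapHomotopyGroup (n + 1) x)

/-- `r : X → Y` exhibits `Y` as a strong deformation retract of `X`: it has a section `i` such that
`i ∘ r` is homotopic to the identity of `X` relative to `i(Y)`. -/
def ContinuousMap.IsStrongDeformationRetraction (r : C(X, Y)) : Prop :=
  ∃ i : C(Y, X), r.comp i = ContinuousMap.id Y ∧
    (i.comp r).HomotopicRel (ContinuousMap.id X) (Set.range i)

end Weak

/-- The component at the finite `G`-set `S` of a map of systems of spaces. -/
def GSystem.component {G : Type u} [Group G] {X Y : GSystem G} (f : X ⟶ Y) (S : FinGSet G) :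
    C((X.obj.obj (op S) : Type u), (Y.obj.obj (op S) : Type u)) :=
  (f.hom.app (op S)).hom.hom

/-- Weak equivalences of systems of spaces are defined componentwise. -/
def GSystem.IsWeakEquiv {G : Type u} [Group G] {X Y : GSystem G} (f : X ⟶ Y) : Prop :=
  ∀ S : FinGSet G, (GSystem.component f S).IsWeakHomotopyEquiv

/-- Weak equivalences of `G`-spaces are the maps that induce weak equivalences of fixed point
systems. -/
def GSpace.IsWeakEquiv {G : Type u} [Group G] {X Y : GSpace G} (f : X ⟶ Y) : Prop :=
  GSystem.IsWeakEquiv ((Phi G).map f)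

/-! Let `S` be an orbit and `s` a point of it. Equivariant maps out of `S` are determined by their
value at `s`, which can be any point fixed by the stabilizer of `s`. Applied to the sets `Sₙ` in the
bar construction, this says that the simplices fixed by the stabilizer are those of the bar
construction with `J` replaced by `Hom(S, -)`. Realization respects this identification: `Map_G(S,
Ψ𝒳)` is homeomorphic to `|B_•(𝒳, G𝓕, Hom(S, -))|` (`Bar.isHomeomorph_toFixed`). A chain in the
latter can be prolonged by `S` itself. This extra degeneracy deforms the realization onto `𝒳(S)`,
over the augmentation and relative to the included copy of `𝒳(S)` (`HomBar.deformation`). The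
augmentation, read through the homeomorphism, is `ε` at `S`.

The delicate point is the homeomorphism. A point of the realization has many representatives `(y,
t)`, and `α ∈ Sₙ` need not be fixed when the point is. Intrinsic to the point is the image of `α` at
the largest vertex with nonzero coordinate (`Bar.carrier`). Truncating the simplex at that vertex
does not change the point and turns it into a fixed simplex, which gives surjectivity. Comparing
different truncations shows that `Bar.evalAt` is injective, and a simplexwise description of its
images shows that it is closed.

A general finite `G`-set is a disjoint union of orbits, and both systems turn it into a product, so
`ε`, its section and its deformation are assembled coordinatewise. `Bar.counit` is characterized by
its restrictions along all maps from orbits, which reduces naturality to orbits. The assembled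
homotopy stays in the fibres of `ε`, which makes `ε` a weak equivalence once the movement of base
points is corrected (`ContinuousMap.IsFiberDeformation.isWeakHomotopyEquiv`). The statement about
`Ψ` follows from naturality of `ε` and two-out-of-three. -/

/-! ### Fibrewise deformation retractions are weak equivalences -/

section FiberDeformation

open unitInterval

variable {X Y : Type*} [TopologicalSpace X] [TopologicalSpace Y]

/-- `r` has a section `i` such that `i ∘ r` is homotopic to the identity over the target. -/
def ContinuousMap.IsFiberDeformation (r : C(X, Y)) : Prop :=
  ∃ (i : C(Y, X)) (K : C(X × I, X)), (∀ y, r (i y) = y) ∧ (∀ x, K (x, 0) = x) ∧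
    (∀ x, K (x, 1) = i (r x)) ∧ ∀ x t, r (K (x, t)) = r x

/-! ### Collars in cubes, for change of base point -/

namespace Cube

variable {n : ℕ}

/-- The dilation of the cube by the factor `1 + s` around its centre, cut off at the boundary. -/
noncomputable def dilate (s : I) (y : Fin (n + 1) → I) : Fin (n + 1) → I := fun j =>
  Set.projIcc (0 : ℝ) 1 zero_le_one ((1 + s) * y j - s / 2)

theorem continuous_dilate : Continuous fun p : I × (Fin (n + 1) → I) => dilate p.1 p.2 := by
  unfold dilate
  refine continuous_pi fun j => continuous_projIcc.comp ?_
  fun_prop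

theorem dilate_zero (y : Fin (n + 1) → I) : dilate 0 y = y := by
  funext j
  simp [dilate]

theorem dilate_mem_boundary (s : I) {y : Fin (n + 1) → I} (hy : y ∈ Cube.boundary (Fin (n + 1))) :
    dilate s y ∈ Cube.boundary (Fin (n + 1)) := by
  obtain ⟨j, hj⟩ := hy
  have h0 := s.2.1
  have h1 := s.2.2
  refine ⟨j, hj.imp (fun h => ?_) fun h => ?_⟩
  · refine Set.projIcc_of_le_left _ ?_
    rw [h]
    simp
    linarith
  · refine Set.projIcc_of_right_le _ ?_
    rw [h]
    simp
    linarith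

/-- The distance from the boundary of the cube. -/
noncomputable def depth (y : Fin (n + 1) → I) : ℝ :=
  Finset.univ.inf' Finset.univ_nonempty fun j => min (y j : ℝ) (1 - y j)

theorem continuous_depth : Continuous (depth (n := n)) := by
  unfold depth
  exact Continuous.finset_inf'_apply _ fun j _ => by fun_prop

theorem depth_eq_zero {y : Fin (n + 1) → I} (hy : y ∈ Cube.boundary (Fin (n + 1))) :
    depth y = 0 := by
  apply le_antisymm
  · obtain ⟨j, hj⟩ := hy
    refine (Finset.inf'_le _ (Finset.mem_univ j)).trans ?_
    rcases hj with h | h <;> simp [h]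
  · exact (Finset.le_inf'_iff _ _).2 fun j _ => le_min (y j).2.1 (sub_nonneg.2 (y j).2.2)

/-- For `s = 1` the dilation is `2 y - 1 / 2` in each coordinate before clamping, which leaves the
open unit interval exactly when `y ≤ 1 / 4` or `y ≥ 3 / 4`. -/
theorem dilate_one_mem_boundary {y : Fin (n + 1) → I} (hy : depth y ≤ 1 / 4) :
    dilate 1 y ∈ Cube.boundary (Fin (n + 1)) := by
  obtain ⟨j, -, hj⟩ := Finset.exists_mem_eq_inf' (s := (Finset.univ : Finset (Fin (n + 1))))
    Finset.univ_nonempty fun j => min (y j : ℝ) (1 - y j)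
  have h : min (y j : ℝ) (1 - y j) ≤ 1 / 4 := hj ▸ hy
  refine ⟨j, (min_le_iff.1 h).imp (fun h => ?_) fun h => ?_⟩
  · refine Set.projIcc_of_le_left _ ?_
    simp
    linarith
  · refine Set.projIcc_of_right_le _ ?_
    simp
    linarith

/-- The distance from the boundary, rescaled and cut off. -/
noncomputable def collarTime (y : Fin (n + 1) → I) : I :=
  Set.projIcc (0 : ℝ) 1 zero_le_one (4 * depth y)

theorem continuous_collarTime : Continuous (collarTime (n := n)) :=
  continuous_projIcc.comp (continuous_const.mul continuous_depth)

theorem collarTime_boundary {y : Fin (n + 1) → I} (hy : y ∈ Cube.boundary (Fin (n + 1))) :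
    collarTime y = 0 := by
  simp [collarTime, depth_eq_zero hy]

theorem collarTime_eq_one {y : Fin (n + 1) → I} (hy : 1 / 4 ≤ depth y) : collarTime y = 1 :=
  Set.projIcc_of_right_le _ (by linarith)

/-- The map on the cube given by `a` on the concentric half size cube and by the path `γ` on the
remaining collar. -/
noncomputable def collar {Z : Type*} (a : (Fin (n + 1) → I) → Z) (γ : I → Z)
    (y : Fin (n + 1) → I) : Z :=
  if 1 / 4 ≤ depth y then a (dilate 1 y) else γ (collarTime y)

/-- At depth `1 / 4` the dilated point lies on the boundary and the collar time is `1`, so both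
branches give `γ 1`. The parameter `s` lets the same statement serve for loops and for homotopies of
loops. -/
theorem continuous_collar {a : I × (Fin (n + 1) → I) → X} {γ : I → X} (ha : Continuous a)
    (hγ : Continuous γ) (h : ∀ s, ∀ y ∈ Cube.boundary (Fin (n + 1)), a (s, y) = γ 1) :
    Continuous fun p : I × (Fin (n + 1) → I) => collar (fun y => a (p.1, y)) γ p.2 := by
  unfold collar
  refine Continuous.if_le ?_ ?_ continuous_const (continuous_depth.comp continuous_snd) ?_
  · refine ha.comp (continuous_fst.prodMk ?_)
    exact continuous_dilate.comp (continuous_const.prodMk continuous_snd)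
  · exact hγ.comp (continuous_collarTime.comp continuous_snd)
  · intro p hp
    exact (h _ _ (dilate_one_mem_boundary hp.ge)).trans (congrArg γ (collarTime_eq_one hp.le)).symm

theorem collar_boundary {Z : Type*} (a : (Fin (n + 1) → I) → Z) (γ : I → Z) {y : Fin (n + 1) → I}
    (hy : y ∈ Cube.boundary (Fin (n + 1))) : collar a γ y = γ 0 := by
  rw [collar, depth_eq_zero hy, if_neg (by norm_num), collarTime_boundary hy]

end Cube

open Cube

/-- A homotopy of maps on the cube that is the path `γ` on the boundary yields a homotopy relative
to the boundary from the initial map to the terminal map with a collar. -/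
theorem GenLoop.homotopic_collar {n : ℕ} {x : X} (p q : GenLoop (Fin (n + 1)) X x)
    (h : C((Fin (n + 1) → I) × I, X)) (γ : I → X) (h0 : ∀ y, h (y, 0) = p y)
    (hb : ∀ y ∈ Cube.boundary (Fin (n + 1)), ∀ t, h (y, t) = γ t)
    (hq : ∀ y, q y = collar (fun y => h (y, 1)) γ y) : GenLoop.Homotopic p q := by
  -- While the cube is dilated, `h` runs up to the collar time, which vanishes on the boundary, so
  -- the boundary stays at the base point. At the end, inner points have completed `h` and collar
  -- points, dilated to the boundary, trace `γ`.
  refine ⟨⟨⟨⟨fun w => h (dilate w.1 w.2, w.1 * collarTime w.2), ?_⟩, fun y => ?_, fun y => ?_⟩,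
    fun s y hy => ?_⟩⟩
  · refine h.continuous.comp (continuous_dilate.prodMk ?_)
    exact continuous_fst.mul (continuous_collarTime.comp continuous_snd)
  · change h (dilate 0 y, 0 * _) = _
    rw [dilate_zero, zero_mul, h0]
    rfl
  · change h (dilate 1 y, 1 * _) = q y
    rw [hq, collar, one_mul]
    split_ifs with hd
    · rw [collarTime_eq_one hd]
    · rw [hb _ (dilate_one_mem_boundary (not_le.1 hd).le)]
  · change h (dilate s y, s * collarTime y) = p y
    rw [collarTime_boundary hy, mul_zero, h0]
    exact (p.2 _ (dilate_mem_boundary s hy)).trans (p.2 y hy).symm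

/-! ### Weak homotopy equivalences from fibrewise deformations and from composites -/

namespace ContinuousMap

theorem IsFiberDeformation.isWeakHomotopyEquiv {r : C(X, Y)} (hr : r.IsFiberDeformation) :
    r.IsWeakHomotopyEquiv := by
  obtain ⟨i, K, hi, hK0, hK1, hKr⟩ := hr
  have hj : ∀ x, Joined x (i (r x)) := fun x =>
    ⟨⟨⟨fun t => K (x, t), by fun_prop⟩, hK0 x, hK1 x⟩⟩
  refine ⟨⟨?_, ?_⟩, fun n x => ⟨?_, ?_⟩⟩
  · intro a b h
    induction a using Quotient.ind with | _ a
    induction b using Quotient.ind with | _ b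
    have h' : Joined (r a) (r b) := Quotient.exact h
    exact Quotient.sound ((hj a).trans ((h'.map i.continuous).trans (hj b).symm))
  · intro b
    induction b using Quotient.ind with | _ b
    exact ⟨Quotient.mk _ (i b), congrArg (Quotient.mk _) (hi b)⟩
  · intro a b h
    induction a using Quotient.ind with | _ p
    induction b using Quotient.ind with | _ q
    obtain ⟨k⟩ := Quotient.exact h
    refine Quotient.sound ?_
    -- The lifted homotopy `i ∘ k` is based at `i (r x)` instead of `x`; the path `K (x, -)` used as
    -- a collar brings the base point back.
    have hk : ∀ s, ∀ y ∈ Cube.boundary (Fin (n + 1)), i (k (s, y)) = K (x, 1) :=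
      fun s y hy => by
        rw [hK1, k.eq_fst s hy]
        exact congrArg (fun z => i (r z)) (p.2 y hy)
    have hc := Cube.continuous_collar (X := X) (a := fun w => i (k w)) (γ := fun t => K (x, t))
      (by fun_prop) (by fun_prop) hk
    let c (s : I) : GenLoop (Fin (n + 1)) X x :=
      ⟨⟨fun y => collar (fun y => i (k (s, y))) (fun t => K (x, t)) y,
        hc.comp (continuous_const.prodMk continuous_id)⟩,
        fun y hy => (collar_boundary (fun y => i (k (s, y))) (fun t => K (x, t)) hy).trans
          (hK0 x)⟩
    have hp : GenLoop.Homotopic p (c 0) := by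
      refine GenLoop.homotopic_collar p _ ⟨fun w => K (p.1 w.1, w.2), by fun_prop⟩
        (fun t => K (x, t)) (fun y => hK0 _) (fun y hy t => ?_) fun y => ?_
      · exact congrArg (fun z => K (z, t)) (p.2 y hy)
      · have hy : c 0 y = collar (fun y => i (k (0, y))) (fun t => K (x, t)) y := rfl
        refine hy.trans (congrArg (fun a => collar a (fun t => K (x, t)) y) (funext fun y => ?_))
        exact (congrArg i (k.apply_zero y)).trans (hK1 _).symm
    have hq : GenLoop.Homotopic q (c 1) := by
      refine GenLoop.homotopic_collar q _ ⟨fun w => K (q.1 w.1, w.2), by fun_prop⟩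
        (fun t => K (x, t)) (fun y => hK0 _) (fun y hy t => ?_) fun y => ?_
      · exact congrArg (fun z => K (z, t)) (q.2 y hy)
      · have hy : c 1 y = collar (fun y => i (k (1, y))) (fun t => K (x, t)) y := rfl
        refine hy.trans (congrArg (fun a => collar a (fun t => K (x, t)) y) (funext fun y => ?_))
        exact (congrArg i (k.apply_one y)).trans (hK1 _).symm
    have hpq : GenLoop.Homotopic (c 0) (c 1) :=
      ⟨⟨⟨⟨fun w => collar (fun y => i (k (w.1, y))) (fun t => K (x, t)) w.2, hc⟩,
        fun _ => rfl, fun _ => rfl⟩, fun s y hy => ((c s).2 y hy).trans ((c 0).2 y hy).symm⟩⟩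
    exact hp.trans (hpq.trans hq.symm)
  · intro b
    induction b using Quotient.ind with | _ q
    have hc := Cube.continuous_collar (X := X) (a := fun w : I × (Fin (n + 1) → I) => i (q.1 w.2))
      (γ := fun t => K (x, t)) (by fun_prop) (by fun_prop) fun s y hy => by
        rw [hK1]
        exact congrArg i (q.2 y hy)
    let p : GenLoop (Fin (n + 1)) X x :=
      ⟨⟨fun y => collar (fun y => i (q.1 y)) (fun t => K (x, t)) y,
        hc.comp (continuous_const (y := (0 : I)) |>.prodMk continuous_id)⟩,
        fun y hy => (collar_boundary (fun y => i (q.1 y)) (fun t => K (x, t)) hy).trans (hK0 x)⟩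
    refine ⟨Quotient.mk _ p, Quotient.sound (GenLoop.Homotopic.symm ?_)⟩
    -- Only here is it needed that `K` preserves fibres: the collar path `K (x, -)` projects to the
    -- constant path at `r x`, so `r ∘ p` is `q` with a constant collar.
    refine GenLoop.homotopic_collar q _ ⟨fun w => q.1 w.1, by fun_prop⟩ (fun t => r x)
      (fun y => rfl) (fun y hy t => q.2 y hy) fun y => ?_
    change r (collar (fun y => i (q.1 y)) (fun t => K (x, t)) y) = _
    unfold collar
    split_ifs
    · exact hi _
    · exact hKr _ _

variable {Z W : Type*} [TopologicalSpace Z] [TopologicalSpace W]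

theorem IsWeakHomotopyEquiv.comp {g : C(Y, Z)} {f : C(X, Y)} (hg : g.IsWeakHomotopyEquiv)
    (hf : f.IsWeakHomotopyEquiv) : (g.comp f).IsWeakHomotopyEquiv := by
  refine ⟨?_, fun n x => ?_⟩
  · convert! hg.1.comp hf.1 using 1
    funext a
    induction a using Quotient.ind
    rfl
  · convert! (hg.2 n (f x)).comp (hf.2 n x) using 1
    funext a
    induction a using Quotient.ind
    rfl

theorem IsWeakHomotopyEquiv.of_comp {g : C(Y, Z)} {f : C(X, Y)} (hg : g.IsWeakHomotopyEquiv)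
    (hgf : (g.comp f).IsWeakHomotopyEquiv) : f.IsWeakHomotopyEquiv := by
  refine ⟨(Function.Bijective.of_comp_iff' hg.1 _).1 ?_,
    fun n x => (Function.Bijective.of_comp_iff' (hg.2 n (f x)) _).1 ?_⟩
  · convert! hgf.1 using 1
    funext a
    induction a using Quotient.ind
    rfl
  · convert! hgf.2 n x using 1
    funext a
    induction a using Quotient.ind
    rfl

end ContinuousMap

end FiberDeformation

/-! ### Products of disjoint unions with a space -/

section SigmaProd

variable {ι : Type*} {X : ι → Type*} [∀ i, TopologicalSpace (X i)] {K : Type*}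
  [TopologicalSpace K]

/-- The product with `K` distributes over the disjoint union. -/
theorem isClosed_sigma_prod {s : Set ((Σ i, X i) × K)}
    (hs : ∀ i, IsClosed {p : X i × K | (⟨i, p.1⟩, p.2) ∈ s}) : IsClosed s := by
  rw [← (Homeomorph.sigmaProdDistrib (X := X) (Y := K)).symm.isClosed_preimage]
  exact isClosed_sigma_iff.2 hs

end SigmaProd

/-! ### The bar construction with values in a represented functor -/

section HomBar

variable {C : Type u} [Category.{0} C] (X : C ⥤ CompactlyGenerated.{u, u}) (Z : C)

/-- The space of `n`-simplices of the bar construction `B_•(X, C, Hom(-, Z))`: chains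
`c₀ ⟶ ⋯ ⟶ cₙ ⟶ Z` together with a point of `X c₀`. -/
abbrev HomBarSpace (n : SimplexCategory) : Type u :=
  Σ p : (Σ c : ComposableArrows C n.len, (c.obj (Fin.last n.len) ⟶ Z)),
    (X.obj (p.1.obj 0) : Type u)

namespace HomBarSpace

variable {X Z}

theorem continuous_mk {n : SimplexCategory}
    (p : Σ c : ComposableArrows C n.len, (c.obj (Fin.last n.len) ⟶ Z)) :
    Continuous (fun x : X.obj (p.1.obj 0) => (⟨p, x⟩ : HomBarSpace X Z n)) :=
  continuous_sigmaMk (σ := fun p : (Σ c : ComposableArrows C n.len,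
    (c.obj (Fin.last n.len) ⟶ Z)) => (X.obj (p.1.obj 0) : Type u)) (i := p)

theorem ext_of_eq {n : SimplexCategory} {c d : ComposableArrows C n.len} (h : c = d)
    {ψ : c.obj (Fin.last n.len) ⟶ Z} {φ : d.obj (Fin.last n.len) ⟶ Z}
    {x : X.obj (c.obj 0)} {y : X.obj (d.obj 0)} (hψ : ψ = eqToHom (by rw [h]) ≫ φ)
    (hx : X.map (eqToHom (by rw [h])) x = y) :
    (⟨⟨c, ψ⟩, x⟩ : HomBarSpace X Z n) = ⟨⟨d, φ⟩, y⟩ := by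
  subst h hψ hx
  simp

theorem ext' {n : SimplexCategory} {c : ComposableArrows C n.len}
    {ψ φ : c.obj (Fin.last n.len) ⟶ Z} {x y : X.obj (c.obj 0)} (hψ : ψ = φ) (hx : x = y) :
    (⟨⟨c, ψ⟩, x⟩ : HomBarSpace X Z n) = ⟨⟨c, φ⟩, y⟩ := by
  subst hψ hx
  rfl

/-- The simplex obtained from a diagram `D` over a preorder with least element `a` and greatest
element `b`, a map `D b ⟶ Z` and a point of `X (D a)` by restriction to a chain in the preorder. -/
def pull {J : Type*} [Preorder J] (D : J ⥤ C) {a b : J} (ha : ∀ j, a ≤ j) (hb : ∀ j, j ≤ b)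
    (ψ : D.obj b ⟶ Z) (x : X.obj (D.obj a)) {m : SimplexCategory} (θ : Fin (m.len + 1) →o J) :
    HomBarSpace X Z m :=
  ⟨⟨θ.monotone.functor ⋙ D, D.map (homOfLE (hb _)) ≫ ψ⟩, X.map (D.map (homOfLE (ha _))) x⟩

/-- The composite `X c₀ ⟶ X cₙ ⟶ X Z` applied to the given point of `X c₀`. -/
def eval {n : SimplexCategory} (b : HomBarSpace X Z n) : X.obj Z :=
  X.map (b.1.1.map (homOfLE (Fin.zero_le _)) ≫ b.1.2) b.2

theorem continuous_eval {n : SimplexCategory} :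
    Continuous (eval : HomBarSpace X Z n → X.obj Z) :=
  continuous_sigma fun p => (X.map (p.1.map (homOfLE (Fin.zero_le _)) ≫ p.2)).hom.hom.continuous

theorem eval_pull {J : Type*} [Preorder J] (D : J ⥤ C) {a b : J} (ha : ∀ j, a ≤ j)
    (hb : ∀ j, j ≤ b) (ψ : D.obj b ⟶ Z) (x : X.obj (D.obj a)) {m : SimplexCategory}
    (θ : Fin (m.len + 1) →o J) :
    eval (pull D ha hb ψ x θ) = X.map (D.map (homOfLE (ha b)) ≫ ψ) x := by
  have h : D.map (homOfLE (ha b)) ≫ ψ = D.map (homOfLE (ha _)) ≫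
      (D.map (homOfLE (θ.monotone (Fin.zero_le (Fin.last m.len)))) ≫
        D.map (homOfLE (hb _)) ≫ ψ) := by
    rw [← D.map_comp_assoc, ← D.map_comp_assoc]
    rfl
  rw [h, X.map_comp]
  rfl

/-- Arrows in a preorder are unique, so the structure maps of the two restrictions compose
correctly. The simplicial identities and the identities for adding a last vertex are all deduced
from this one. -/
theorem pull_comp {J J' : Type*} [Preorder J] [Preorder J'] (D : J ⥤ C) {a b : J}
    (ha : ∀ j, a ≤ j) (hb : ∀ j, j ≤ b) {a' b' : J'} (ha' : ∀ j, a' ≤ j) (hb' : ∀ j, j ≤ b')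
    (ψ : D.obj b ⟶ Z) (x : X.obj (D.obj a)) {m : SimplexCategory} (φ : J' →o J)
    (θ : Fin (m.len + 1) →o J') :
    pull D ha hb ψ x (φ.comp θ) = pull (φ.monotone.functor ⋙ D) ha' hb'
      (D.map (homOfLE (hb (φ b'))) ≫ ψ) (X.map (D.map (homOfLE (ha (φ a')))) x) θ := by
  refine HomBarSpace.ext' (c := (φ.comp θ).monotone.functor ⋙ D) ?_ ?_
  · have h : D.map (homOfLE (φ.monotone (hb' (θ (Fin.last m.len))))) ≫
        D.map (homOfLE (hb (φ b'))) = D.map (homOfLE (hb (φ (θ (Fin.last m.len))))) := by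
      rw [← D.map_comp]
      rfl
    exact (congrArg (· ≫ ψ) h.symm).trans (Category.assoc _ _ _)
  · have h : X.map (D.map (homOfLE (ha (φ a')))) ≫
        X.map (D.map (homOfLE (φ.monotone (ha' (θ 0))))) =
        X.map (D.map (homOfLE (ha (φ (θ 0))))) := by
      rw [← X.map_comp, ← D.map_comp]
      rfl
    exact ConcreteCategory.congr_hom h.symm x

theorem pull_congr {J : Type*} [Preorder J] {D D' : J ⥤ C} (h : D = D') {a b : J}
    (ha : ∀ j, a ≤ j) (hb : ∀ j, j ≤ b) {ψ : D.obj b ⟶ Z} {ψ' : D'.obj b ⟶ Z}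
    {x : X.obj (D.obj a)} {x' : X.obj (D'.obj a)} (hψ : ψ = eqToHom (by rw [h]) ≫ ψ')
    (hx : X.map (eqToHom (by rw [h])) x = x') {m : SimplexCategory} (θ : Fin (m.len + 1) →o J) :
    pull D ha hb ψ x θ = pull D' ha hb ψ' x' θ := by
  subst h hψ hx
  simp

end HomBarSpace

open HomBarSpace

/-- The simplicial operators of `B_•(X, C, Hom(-, Z))`. -/
def homBarMap {m n : SimplexCategory} (θ : m ⟶ n) : C(HomBarSpace X Z n, HomBarSpace X Z m) where
  toFun b :=
    ⟨⟨b.1.1.whiskerLeft (SimplexCategory.toCat.map θ).toFunctor,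
      b.1.1.map (homOfLE (Fin.le_last (θ (Fin.last m.len)))) ≫ b.1.2⟩,
      X.map (b.1.1.map (homOfLE (Fin.zero_le (θ 0)))) b.2⟩
  continuous_toFun := by
    refine continuous_sigma fun p => ?_
    exact (HomBarSpace.continuous_mk (X := X) (n := m)
      ⟨p.1.whiskerLeft (SimplexCategory.toCat.map θ).toFunctor,
        p.1.map (homOfLE (Fin.le_last (θ (Fin.last m.len)))) ≫ p.2⟩).comp
      (X.map (p.1.map (homOfLE (Fin.zero_le (θ 0))))).hom.hom.continuous

variable {X Z}

theorem homBarMap_eq_pull {m n : SimplexCategory} (θ : m ⟶ n) (b : HomBarSpace X Z n) :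
    homBarMap X Z θ b = pull b.1.1 Fin.zero_le Fin.le_last b.1.2 b.2 θ.toOrderHom := rfl

theorem homBarMap_pull {J : Type*} [Preorder J] (D : J ⥤ C) {a b : J} (ha : ∀ j, a ≤ j)
    (hb : ∀ j, j ≤ b) (ψ : D.obj b ⟶ Z) (x : X.obj (D.obj a)) {l m : SimplexCategory} (η : l ⟶ m)
    (θ : Fin (m.len + 1) →o J) :
    homBarMap X Z η (pull D ha hb ψ x θ) = pull D ha hb ψ x (θ.comp η.toOrderHom) :=
  (pull_comp D ha hb Fin.zero_le Fin.le_last ψ x θ η.toOrderHom).symm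

theorem eval_homBarMap {m n : SimplexCategory} (θ : m ⟶ n) (b : HomBarSpace X Z n) :
    eval (homBarMap X Z θ b) = eval b := by
  rw [homBarMap_eq_pull, eval_pull]
  rfl

theorem homBarMap_id (n : SimplexCategory) (b : HomBarSpace X Z n) :
    homBarMap X Z (𝟙 n) b = b := by
  obtain ⟨⟨c, ψ⟩, x⟩ := b
  refine HomBarSpace.ext' ?_ ?_
  · change c.map (𝟙 (Fin.last n.len)) ≫ ψ = ψ
    simp
  · change X.map (c.map (𝟙 0)) x = x
    simp

theorem homBarMap_comp {l m n : SimplexCategory} (η : l ⟶ m) (θ : m ⟶ n)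
    (b : HomBarSpace X Z n) :
    homBarMap X Z (η ≫ θ) b = homBarMap X Z η (homBarMap X Z θ b) := by
  rw [homBarMap_eq_pull θ, homBarMap_pull]
  rfl

variable (X Z) in
/-- The simplicial space `B_•(X, C, Hom(-, Z))`. -/
def homBar : SimplicialObject CompactlyGenerated.{u, u} where
  obj n := CompactlyGenerated.of (HomBarSpace X Z n.unop)
  map θ := CompactlyGenerated.ofHom (homBarMap X Z θ.unop)
  map_id n := ConcreteCategory.hom_ext _ _ (homBarMap_id n.unop)
  map_comp f g := ConcreteCategory.hom_ext _ _ (homBarMap_comp g.unop f.unop)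

/-! #### Adding `Z` to the end of a chain -/

/-- The diagram over `WithTop (Fin (n + 1))` obtained from a chain `c₀ ⟶ ⋯ ⟶ cₙ ⟶ Z`. -/
def coneDiagram {n : ℕ} (c : ComposableArrows C n) (ψ : c.obj (Fin.last n) ⟶ Z) :
    WithTop (Fin (n + 1)) ⥤ C where
  obj i := match i with
    | (i : Fin (n + 1)) => c.obj i
    | ⊤ => Z
  map {i j} f := match i, j, f with
    | (i : Fin (n + 1)), (j : Fin (n + 1)), f => c.map (homOfLE (WithTop.coe_le_coe.1 (leOfHom f)))
    | (i : Fin (n + 1)), ⊤, _ => c.map (homOfLE (Fin.le_last i)) ≫ ψ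
    | ⊤, ⊤, _ => 𝟙 Z
    | ⊤, (j : Fin (n + 1)), f => (WithTop.not_top_le_coe j (leOfHom f)).elim
  map_id i := by
    cases i
    · rfl
    · exact c.map_id _
  map_comp {i j k} f g := by
    cases i <;> cases j <;> cases k
    case coe.coe.coe => exact c.map_comp (homOfLE _) (homOfLE _)
    case coe.coe.top i j =>
      have h : c.map (homOfLE (WithTop.coe_le_coe.1 (leOfHom f))) ≫ c.map (homOfLE j.le_last) =
          c.map (homOfLE i.le_last) := (c.map_comp _ _).symm
      exact (congrArg (· ≫ ψ) h.symm).trans (Category.assoc _ _ _)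
    case coe.top.top => exact (Category.comp_id _).symm
    case top.top.top => exact (Category.comp_id _).symm
    all_goals exact (WithTop.not_top_le_coe _ (leOfHom ‹(⊤ : WithTop (Fin (n + 1))) ⟶ WithTop.some _›)).elim

/-- The simplex category object with one more vertex. -/
abbrev SimplexCategory.next (n : SimplexCategory) : SimplexCategory :=
  SimplexCategory.mk (n.len + 1)

namespace SimplexCategory

/-- The inclusion that omits the last vertex. -/
def inclNext (n : SimplexCategory) : n ⟶ n.next :=
  SimplexCategory.Hom.mk ⟨Fin.castSucc, fun _ _ h => Fin.castSucc_le_castSucc_iff.2 h⟩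

/-- The inclusion of the last vertex. -/
def lastNext (n : SimplexCategory) : SimplexCategory.mk 0 ⟶ n.next :=
  SimplexCategory.Hom.mk ⟨fun _ => Fin.last _, fun _ _ _ => le_rfl⟩

/-- The map to the point. -/
def toPoint (n : SimplexCategory) : n ⟶ SimplexCategory.mk 0 :=
  SimplexCategory.Hom.mk ⟨fun _ => 0, fun _ _ _ => le_rfl⟩

/-- The monotone map that preserves the last vertices. -/
def mapNext {m n : SimplexCategory} (θ : m ⟶ n) : m.next ⟶ n.next :=
  SimplexCategory.Hom.mk ⟨Fin.lastCases (Fin.last _) fun i => (θ i).castSucc, by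
    intro i j h
    induction i using Fin.lastCases with
    | last =>
      have hj : j = Fin.last _ := le_antisymm (Fin.le_last _) h
      rw [hj]
    | cast i =>
      induction j using Fin.lastCases with
      | last =>
        simp only [Fin.lastCases_last]
        exact Fin.le_last _
      | cast j =>
        simp only [Fin.lastCases_castSucc]
        exact Fin.castSucc_le_castSucc_iff.2
          (θ.toOrderHom.monotone (Fin.castSucc_le_castSucc_iff.1 h))⟩

/-- The vertices of `n.next` with the last one as top element. -/
def nextToWithTop (n : ℕ) : Fin (n + 2) →o WithTop (Fin (n + 1)) :=
  ⟨Fin.lastCases ⊤ fun i => (i : WithTop (Fin (n + 1))), by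
    intro i j h
    induction j using Fin.lastCases with
    | last => simp
    | cast j =>
      induction i using Fin.lastCases with
      | last => exact absurd h (not_le.2 (Fin.castSucc_lt_last _))
      | cast i =>
        simp only [Fin.lastCases_castSucc]
        exact WithTop.coe_le_coe.2 (Fin.castSucc_le_castSucc_iff.1 h)⟩

theorem nextToWithTop_castSucc {n : ℕ} (i : Fin (n + 1)) :
    nextToWithTop n i.castSucc = (i : WithTop (Fin (n + 1))) := by
  change Fin.lastCases (motive := fun _ => WithTop (Fin (n + 1))) _ _ _ = _
  simp

theorem nextToWithTop_last (n : ℕ) : nextToWithTop n (Fin.last _) = ⊤ := by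
  change Fin.lastCases (motive := fun _ => WithTop (Fin (n + 1))) _ _ _ = _
  simp

theorem mapNext_castSucc {m n : SimplexCategory} (θ : m ⟶ n) (i : Fin (m.len + 1)) :
    mapNext θ (i.castSucc : Fin (m.len + 2)) = ((θ i).castSucc : Fin (n.len + 2)) := by
  change Fin.lastCases (motive := fun _ => Fin (n.len + 2)) _ _ _ = _
  simp

theorem mapNext_last {m n : SimplexCategory} (θ : m ⟶ n) :
    mapNext θ (Fin.last _ : Fin (m.len + 2)) = (Fin.last _ : Fin (n.len + 2)) := by
  change Fin.lastCases (motive := fun _ => Fin (n.len + 2)) _ _ _ = _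
  simp

end SimplexCategory

open SimplexCategory

theorem WithTop.coe_zero_le' {n : ℕ} (j : WithTop (Fin (n + 1))) :
    ((0 : Fin (n + 1)) : WithTop (Fin (n + 1))) ≤ j := by
  cases j
  · exact le_top
  · exact WithTop.coe_le_coe.2 (Fin.zero_le _)

/-! ### The extra degeneracy and its identities -/

namespace HomBarSpace

/-- The restriction of the diagram `c₀ ⟶ ⋯ ⟶ cₙ ⟶ Z` along a monotone map. -/
def conePull {n : SimplexCategory} (b : HomBarSpace X Z n) {m : SimplexCategory}
    (θ : Fin (m.len + 1) →o WithTop (Fin (n.len + 1))) : HomBarSpace X Z m :=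
  pull (coneDiagram b.1.1 b.1.2) WithTop.coe_zero_le' (fun _ => le_top) (𝟙 Z) b.2 θ

theorem homBarMap_conePull {n : SimplexCategory} (b : HomBarSpace X Z n) {l m : SimplexCategory}
    (η : l ⟶ m) (θ : Fin (m.len + 1) →o WithTop (Fin (n.len + 1))) :
    homBarMap X Z η (b.conePull θ) = b.conePull (θ.comp η.toOrderHom) :=
  homBarMap_pull _ _ _ _ _ _ _

/-- Adding the object `Z` to the end of the chain. -/
def cone {n : SimplexCategory} (b : HomBarSpace X Z n) : HomBarSpace X Z n.next :=
  b.conePull (m := n.next) (nextToWithTop n.len)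

theorem continuous_cone {n : SimplexCategory} :
    Continuous (cone : HomBarSpace X Z n → HomBarSpace X Z n.next) := by
  refine continuous_sigma fun p => ?_
  exact (HomBarSpace.continuous_mk (X := X) (Z := Z) (n := n.next)
    ⟨(nextToWithTop n.len).monotone.functor ⋙ coneDiagram p.1 p.2,
      (coneDiagram p.1 p.2).map (homOfLE le_top) ≫ 𝟙 Z⟩).comp
    (X.map ((coneDiagram p.1 p.2).map (homOfLE (WithTop.coe_zero_le' _)))).hom.hom.continuous

variable (X Z) in
/-- The chain of identities of `Z`. -/
def const (n : SimplexCategory) (x : X.obj Z) : HomBarSpace X Z n :=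
  ⟨⟨(Functor.const _).obj Z, 𝟙 Z⟩, x⟩

theorem continuous_const' (n : SimplexCategory) : Continuous (const X Z n) :=
  HomBarSpace.continuous_mk (X := X) (Z := Z) ⟨(Functor.const _).obj Z, 𝟙 Z⟩

theorem eval_const (n : SimplexCategory) (x : X.obj Z) : eval (const X Z n x) = x := by
  change X.map (𝟙 Z ≫ 𝟙 Z) x = x
  simp

theorem homBarMap_const {m n : SimplexCategory} (θ : m ⟶ n) (x : X.obj Z) :
    homBarMap X Z θ (const X Z n x) = const X Z m x := by
  refine HomBarSpace.ext' ?_ ?_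
  · exact Category.comp_id _
  · change X.map (𝟙 Z) x = x
    simp

theorem eval_cone {n : SimplexCategory} (b : HomBarSpace X Z n) : eval b.cone = eval b := by
  refine (eval_pull _ WithTop.coe_zero_le' (fun _ => le_top) _ _ _).trans ?_
  exact congrArg (fun f : b.1.1.obj 0 ⟶ Z => X.map f b.2) (Category.comp_id _)

/-- Dropping the added vertex undoes the cone; this makes the deformation start at the identity. -/
theorem homBarMap_inclNext_cone {n : SimplexCategory} (b : HomBarSpace X Z n) :
    homBarMap X Z n.inclNext b.cone = b := by
  have h : (nextToWithTop n.len).comp n.inclNext.toOrderHom =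
      ⟨fun i => (i : WithTop (Fin (n.len + 1))), fun i j h => WithTop.coe_le_coe.2 h⟩ := by
    ext1
    funext i
    exact nextToWithTop_castSucc i
  rw [cone, homBarMap_conePull, h]
  refine HomBarSpace.ext' (c := b.1.1) ?_ ?_
  · change (b.1.1.map (𝟙 (Fin.last _)) ≫ b.1.2) ≫ 𝟙 Z = b.1.2
    simp
  · change X.map (b.1.1.map (𝟙 0)) b.2 = b.2
    simp

/-- The added vertex alone retains only the image of the point in `X Z`; this makes the deformation
end in the included copy of `X Z`. -/
theorem homBarMap_lastNext_cone {n : SimplexCategory} (b : HomBarSpace X Z n) :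
    homBarMap X Z n.lastNext b.cone = const X Z _ (eval b) := by
  have h : (nextToWithTop n.len).comp n.lastNext.toOrderHom = ⟨fun i => ⊤, fun i j h => le_rfl⟩ := by
    ext1
    funext i
    exact nextToWithTop_last _
  rw [cone, homBarMap_conePull, h]
  refine HomBarSpace.ext_of_eq (d := (Functor.const _).obj Z) ?_ ?_ ?_
  · exact Functor.hext (fun _ => rfl) fun _ _ _ => HEq.rfl
  · rfl
  · change X.map (𝟙 Z) _ = _
    rw [X.map_id]
    rfl

theorem coneDiagram_whiskerLeft {m n : SimplexCategory} (θ : m ⟶ n)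
    (c : ComposableArrows C n.len) (ψ : c.obj (Fin.last n.len) ⟶ Z) :
    coneDiagram (c.whiskerLeft (SimplexCategory.toCat.map θ).toFunctor)
      (c.map (homOfLE (Fin.le_last (θ (Fin.last m.len)))) ≫ ψ) =
    (θ.toOrderHom.monotone.withTop_map).functor ⋙ coneDiagram c ψ := by
  refine Functor.hext (fun i => ?_) fun i j f => ?_
  · cases i <;> rfl
  · cases i <;> cases j
    case coe.coe => exact HEq.rfl
    case top.top => exact HEq.rfl
    case coe.top i =>
      refine heq_of_eq ?_
      have h : c.map (homOfLE (θ.toOrderHom.monotone i.le_last)) ≫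
          c.map (homOfLE (θ (Fin.last m.len)).le_last) = c.map (homOfLE (θ i).le_last) :=
        (c.map_comp _ _).symm
      exact (Category.assoc _ _ _).symm.trans (congrArg (· ≫ ψ) h)
    all_goals exact (WithTop.not_top_le_coe _ (leOfHom f)).elim

/-- The cone is natural for operators extended by the last vertex, so coning off simplices descends
to the realization. -/
theorem homBarMap_mapNext_cone {m n : SimplexCategory} (θ : m ⟶ n) (b : HomBarSpace X Z n) :
    homBarMap X Z (mapNext θ) b.cone = (homBarMap X Z θ b).cone := by
  have h : (nextToWithTop n.len).comp (mapNext θ).toOrderHom =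
      (⟨_, θ.toOrderHom.monotone.withTop_map⟩ : WithTop _ →o WithTop _).comp
        (nextToWithTop m.len) := by
    ext1
    funext i
    change nextToWithTop n.len (mapNext θ i) = WithTop.map θ.toOrderHom (nextToWithTop m.len i)
    induction i using Fin.lastCases with
    | last =>
      erw [mapNext_last, nextToWithTop_last, nextToWithTop_last]
      rfl
    | cast i =>
      erw [mapNext_castSucc, nextToWithTop_castSucc, nextToWithTop_castSucc]
      rfl
  rw [cone, homBarMap_conePull, h]
  refine (pull_comp _ _ _ WithTop.coe_zero_le' (fun _ => le_top) _ _ _ _).trans ?_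
  refine pull_congr (coneDiagram_whiskerLeft θ b.1.1 b.1.2).symm _ _ ?_ ?_ _
  · rfl
  · exact ConcreteCategory.congr_hom (X.map_id _) _

/-- Together with the degeneracy of constant chains, this makes the deformation stationary on the
included copy of `X Z`. -/
theorem cone_const (n : SimplexCategory) (x : X.obj Z) :
    (const X Z n x).cone = const X Z n.next x := by
  have h : coneDiagram ((Functor.const (Fin (n.len + 1))).obj Z) (𝟙 Z) = (Functor.const _).obj Z := by
    refine Functor.hext (fun i => ?_) fun i j f => ?_
    · cases i <;> rfl
    · cases i <;> cases j
      case coe.coe => exact HEq.rfl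
      case top.top => exact HEq.rfl
      case coe.top i => exact heq_of_eq (Category.comp_id _)
      all_goals exact (WithTop.not_top_le_coe _ (leOfHom f)).elim
  have hx : ∀ x : X.obj Z, X.map (𝟙 Z) x = x := ConcreteCategory.congr_hom (X.map_id Z)
  refine (pull_congr (ψ' := 𝟙 Z) (x' := x) h WithTop.coe_zero_le' (fun _ => le_top) ?_ (hx x) _).trans ?_
  · exact (Category.comp_id _).symm
  · exact HomBarSpace.ext' (Category.comp_id _) (hx x)

end HomBarSpace

/-! #### The deformation of the realization -/

/-- Convex combinations of points of a simplex. -/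
noncomputable def stdSimplex.mix {ι : Type*} [Fintype ι] (u : unitInterval)
    (s t : stdSimplex ℝ ι) : stdSimplex ℝ ι :=
  ⟨((1 - u : ℝ) • s.1 + (u : ℝ) • t.1), convex_stdSimplex ℝ ι s.2 t.2
    (sub_nonneg.2 u.2.2) u.2.1 (by ring)⟩

namespace stdSimplex

variable {ι κ : Type*} [Fintype ι] [Fintype κ]

theorem map_mix (f : ι → κ) (u : unitInterval) (s t : stdSimplex ℝ ι) :
    map f (mix u s t) = mix u (map f s) (map f t) := by
  apply Subtype.ext
  change FunOnFinite.linearMap ℝ ℝ f ((1 - u : ℝ) • s.1 + (u : ℝ) • t.1) = _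
  rw [map_add, map_smul, map_smul]
  rfl

theorem mix_zero (s t : stdSimplex ℝ ι) : mix 0 s t = s := by
  apply Subtype.ext
  simp [mix]

theorem mix_one (s t : stdSimplex ℝ ι) : mix 1 s t = t := by
  apply Subtype.ext
  simp [mix]

theorem continuous_mix :
    Continuous fun p : (stdSimplex ℝ ι × stdSimplex ℝ ι) × unitInterval =>
      mix p.2 p.1.1 p.1.2 := by
  unfold mix
  refine Continuous.subtype_mk ?_ _
  fun_prop

end stdSimplex

namespace HomBar

variable (X Z) in
/-- The realization of `B_•(X, C, Hom(-, Z))`. -/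
abbrev Space : Type u := SimplicialSpace.Realization (homBar X Z)

/-- The point of the realization given by a simplex and barycentric coordinates. -/
def mk {n : SimplexCategory} (b : HomBarSpace X Z n) (t : stdSimplex ℝ (Fin (n.len + 1))) :
    Space X Z :=
  Quot.mk _ ⟨n, (b, t)⟩

theorem continuous_mk (n : SimplexCategory) :
    Continuous fun p : HomBarSpace X Z n × stdSimplex ℝ (Fin (n.len + 1)) => mk p.1 p.2 :=
  continuous_quot_mk.comp (continuous_sigmaMk (σ := fun n : SimplexCategory =>
    HomBarSpace X Z n × stdSimplex ℝ (Fin (n.len + 1))))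

theorem mk_map {m n : SimplexCategory} (θ : m ⟶ n) (b : HomBarSpace X Z n)
    (t : stdSimplex ℝ (Fin (m.len + 1))) :
    mk (homBarMap X Z θ b) t = mk b (stdSimplex.map θ t) :=
  Quot.sound (.glue (Y := homBar X Z) θ b t)

theorem ind {P : Space X Z → Prop}
    (h : ∀ (n : SimplexCategory) (b : HomBarSpace X Z n) t, P (mk b t)) (z : Space X Z) : P z := by
  induction z using Quot.ind with | _ p
  exact h p.1 p.2.1 p.2.2

/-- A function on the realization. -/
def lift {W : Type*} (f : ∀ n : SimplexCategory, HomBarSpace X Z n →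
      stdSimplex ℝ (Fin (n.len + 1)) → W)
    (h : ∀ (m n : SimplexCategory) (θ : m ⟶ n) (b : HomBarSpace X Z n) t,
      f m (homBarMap X Z θ b) t = f n b (stdSimplex.map θ t)) : Space X Z → W :=
  Quot.lift (fun p => f p.1 p.2.1 p.2.2) (by
    rintro _ _ ⟨θ, b, t⟩
    exact h _ _ θ b t)

theorem continuous_lift {W : Type*} [TopologicalSpace W]
    {f : ∀ n : SimplexCategory, HomBarSpace X Z n → stdSimplex ℝ (Fin (n.len + 1)) → W} {h}
    (hf : ∀ n, Continuous fun p : HomBarSpace X Z n × _ => f n p.1 p.2) :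
    Continuous (lift f h) :=
  continuous_quot_lift _ (continuous_sigma hf)

variable (X Z) in
/-- The augmentation `|B_•(X, C, Hom(-, Z))| → X Z`. -/
def augmentation : C(Space X Z, X.obj Z) where
  toFun := lift (fun _ b _ => b.eval) fun _ _ θ b _ => eval_homBarMap θ b
  continuous_toFun := continuous_lift fun _ => continuous_eval.comp continuous_fst

variable (X Z) in
/-- The inclusion of `X Z` in `|B_•(X, C, Hom(-, Z))|` by the identity of `Z`. -/
def inclusion : C(X.obj Z, Space X Z) where
  toFun x := mk (const X Z (SimplexCategory.mk 0) x) (stdSimplex.vertex 0)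
  continuous_toFun := (continuous_mk _).comp ((continuous_const' _).prodMk continuous_const)

theorem mk_const {n : SimplexCategory} (x : X.obj Z) (t : stdSimplex ℝ (Fin (n.len + 1))) :
    mk (const X Z n x) t = inclusion X Z x := by
  rw [← homBarMap_const n.toPoint, mk_map]
  -- The constant chain is degenerate on a vertex, and the 0-dimensional simplex has only one point
  -- of coordinates.
  have : Subsingleton (Fin ((SimplexCategory.mk 0).len + 1)) :=
    inferInstanceAs (Subsingleton (Fin 1))
  exact congrArg (mk _) (Subsingleton.elim _ _)

theorem augmentation_inclusion (x : X.obj Z) : augmentation X Z (inclusion X Z x) = x :=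
  eval_const _ x

/-- The coordinates in the cone on a simplex. -/
noncomputable def coneCoord {n : SimplexCategory} (t : stdSimplex ℝ (Fin (n.len + 1)))
    (u : unitInterval) : stdSimplex ℝ (Fin (n.next.len + 1)) :=
  stdSimplex.mix u (stdSimplex.map n.inclNext t) (stdSimplex.vertex (Fin.last _))

theorem map_mapNext_coneCoord {m n : SimplexCategory} (θ : m ⟶ n)
    (t : stdSimplex ℝ (Fin (m.len + 1))) (u : unitInterval) :
    stdSimplex.map (mapNext θ) (coneCoord t u) = coneCoord (stdSimplex.map θ t) u := by
  rw [coneCoord, coneCoord, stdSimplex.map_mix, stdSimplex.map_comp_apply,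
    stdSimplex.map_comp_apply, stdSimplex.map_vertex]
  congr 2
  · funext i
    exact mapNext_castSucc θ i
  · exact mapNext_last θ

theorem continuous_coneCoord {n : SimplexCategory} :
    Continuous fun p : stdSimplex ℝ (Fin (n.len + 1)) × unitInterval => coneCoord p.1 p.2 :=
  stdSimplex.continuous_mix.comp ((((stdSimplex.continuous_map _).comp continuous_fst).prodMk
    continuous_const).prodMk continuous_snd)

/-- The deformation of the realization, as a family of paths. -/
noncomputable def deformationPath : Space X Z → C(unitInterval, Space X Z) :=
  lift (fun _ b t => ⟨fun u => mk b.cone (coneCoord t u), (continuous_mk _).comp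
      (continuous_const.prodMk (continuous_coneCoord.comp (continuous_const.prodMk continuous_id)))⟩)
    fun m n θ b t => by
      ext u
      change mk (homBarMap X Z θ b).cone (coneCoord t u) = mk b.cone (coneCoord _ u)
      rw [← homBarMap_mapNext_cone, mk_map, map_mapNext_coneCoord]

/-- Currying the time variable allows continuity to be checked on simplices, with no need to show
that the product of the quotient map with the interval is again a quotient map. -/
theorem continuous_deformationPath : Continuous (deformationPath (X := X) (Z := Z)) := by
  refine continuous_lift fun n => ContinuousMap.continuous_of_continuous_uncurry _ ?_
  refine (continuous_mk _).comp ((continuous_cone.comp (continuous_fst.comp continuous_fst)).prodMk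
    (continuous_coneCoord.comp ((continuous_snd.comp continuous_fst).prodMk continuous_snd)))

variable (X Z) in
/-- The deformation of the realization to the image of the inclusion. -/
noncomputable def deformation : C(Space X Z × unitInterval, Space X Z) :=
  ⟨fun p => deformationPath p.1 p.2,
    ContinuousMap.continuous_uncurry_of_continuous ⟨_, continuous_deformationPath⟩⟩

theorem deformation_mk {n : SimplexCategory} (b : HomBarSpace X Z n)
    (t : stdSimplex ℝ (Fin (n.len + 1))) (u : unitInterval) :
    deformation X Z (mk b t, u) = mk b.cone (coneCoord t u) := rfl

theorem deformation_zero (z : Space X Z) : deformation X Z (z, 0) = z := by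
  induction z using ind with | _ n b t
  rw [deformation_mk, coneCoord, stdSimplex.mix_zero, ← mk_map, homBarMap_inclNext_cone]

theorem deformation_one (z : Space X Z) :
    deformation X Z (z, 1) = inclusion X Z (augmentation X Z z) := by
  induction z using ind with | _ n b t
  have h : stdSimplex.map n.lastNext (stdSimplex.vertex (S := ℝ) 0) =
      stdSimplex.vertex (Fin.last _) := stdSimplex.map_vertex _ _
  rw [deformation_mk, coneCoord, stdSimplex.mix_one, ← h, ← mk_map, homBarMap_lastNext_cone]
  rfl

theorem augmentation_deformation (z : Space X Z) (u : unitInterval) :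
    augmentation X Z (deformation X Z (z, u)) = augmentation X Z z := by
  induction z using ind with | _ n b t
  exact eval_cone b

theorem deformation_inclusion (x : X.obj Z) (u : unitInterval) :
    deformation X Z (inclusion X Z x, u) = inclusion X Z x := by
  refine (deformation_mk _ _ _).trans ?_
  rw [cone_const, mk_const]

end HomBar

end HomBar

/-! ### Supports of barycentric coordinates -/

namespace stdSimplex

variable {ι κ : Type*} [Fintype ι] [Fintype κ]

theorem map_apply [DecidableEq κ] (f : ι → κ) (t : stdSimplex ℝ ι) (j : κ) :
    map f t j = ∑ i with f i = j, t i := by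
  rw [map_coe, FunOnFinite.linearMap_apply_apply]

theorem map_congr {f g : ι → κ} {t : stdSimplex ℝ ι} (h : ∀ i, t i ≠ 0 → f i = g i) :
    map f t = map g t := by
  classical
  ext j
  rw [map_apply, map_apply, Finset.sum_filter, Finset.sum_filter]
  refine Finset.sum_congr rfl fun i _ => ?_
  by_cases hi : t i = 0
  · simp [hi]
  · rw [h i hi]

theorem map_apply_ne_zero_iff (f : ι → κ) (t : stdSimplex ℝ ι) (j : κ) :
    map f t j ≠ 0 ↔ ∃ i, f i = j ∧ t i ≠ 0 := by
  classical
  rw [map_apply, Ne, Finset.sum_eq_zero_iff_of_nonneg fun i _ => zero_le t i]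
  simp

theorem support_nonempty (t : stdSimplex ℝ ι) : (Finset.univ.filter fun i => t i ≠ 0).Nonempty := by
  by_contra h
  rw [Finset.not_nonempty_iff_eq_empty, Finset.filter_eq_empty_iff] at h
  have h1 := sum_eq_one t
  rw [Finset.sum_eq_zero fun i hi => not_not.1 (h hi)] at h1
  exact zero_ne_one h1

variable [LinearOrder ι] [LinearOrder κ]

/-- The largest index with a nonzero coordinate. -/
noncomputable def top (t : stdSimplex ℝ ι) : ι :=
  (Finset.univ.filter fun i => t i ≠ 0).max' (support_nonempty t)

theorem apply_top_ne_zero (t : stdSimplex ℝ ι) : t (top t) ≠ 0 :=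
  (Finset.mem_filter.1 (Finset.max'_mem _ (support_nonempty t))).2

theorem le_top {t : stdSimplex ℝ ι} {i : ι} (hi : t i ≠ 0) : i ≤ top t :=
  Finset.le_max' _ _ (Finset.mem_filter.2 ⟨Finset.mem_univ i, hi⟩)

/-- The set is the face on which all coordinates beyond `k` vanish. -/
theorem isClosed_top_le (k : ι) :
    IsClosed {t : stdSimplex ℝ ι | top t ≤ k} := by
  have h : {t : stdSimplex ℝ ι | top t ≤ k} = ⋂ i, ⋂ _ : k < i, {t | t.1 i = 0} := by
    ext t
    simp only [Set.mem_iInter]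
    constructor
    · intro h i hi
      by_contra h0
      exact absurd (h.trans_lt hi) (not_lt.2 (le_top h0))
    · intro h
      by_contra hk
      exact apply_top_ne_zero t (h _ (not_le.1 hk))
  rw [h]
  refine isClosed_iInter fun i => isClosed_iInter fun _ => ?_
  exact isClosed_eq ((continuous_apply i).comp continuous_subtype_val) continuous_const

/-- Coordinates are nonnegative, so nothing cancels and the support of the pushforward is the image
of the support; a monotone map sends its largest element to the largest. -/
theorem top_map {f : ι → κ} (hf : Monotone f) (t : stdSimplex ℝ ι) :
    top (map f t) = f (top t) := by
  apply le_antisymm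
  · obtain ⟨i, hi, ht⟩ := (map_apply_ne_zero_iff f t _).1 (apply_top_ne_zero (map f t))
    rw [← hi]
    exact hf (le_top ht)
  · exact le_top ((map_apply_ne_zero_iff f t _).2 ⟨_, rfl, apply_top_ne_zero t⟩)

end stdSimplex

theorem stdSimplex.top_map_hom {m n : SimplexCategory} (θ : m ⟶ n)
    (t : stdSimplex ℝ (Fin (m.len + 1))) : top (map θ t) = θ (top t) :=
  top_map θ.toOrderHom.monotone t

/-- The operator `i ↦ min i k`. -/
def SimplexCategory.truncate (n : SimplexCategory) (k : Fin (n.len + 1)) : n ⟶ n :=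
  SimplexCategory.Hom.mk ⟨fun i => min i k, fun _ _ h => min_le_min_right k h⟩

theorem SimplexCategory.truncate_apply {n : SimplexCategory} (k i : Fin (n.len + 1)) :
    n.truncate k i = min i k := rfl

/-- Truncation moves only vertices beyond `k`, which carry no weight. Hence a simplex may be
replaced by its truncation without changing the point of the realization. -/
theorem stdSimplex.map_truncate {n : SimplexCategory} {k : Fin (n.len + 1)}
    {t : stdSimplex ℝ (Fin (n.len + 1))} (h : top t ≤ k) : map (n.truncate k) t = t := by
  conv_rhs => rw [← map_id_apply t]
  exact map_congr fun i hi => min_eq_left ((le_top hi).trans h)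

/-! ### Fixed points of the bar construction -/

section FixedPoints

variable {G : Type u} [Group G] (X : (FinGSet G)ᵒᵖ ⥤ CompactlyGenerated.{u, u})

/-- The `G`-space `B(X, G𝓕, J)`. -/
abbrev barGSpace : GSpace G := (geometricRealization.mapAction G).obj (barAction X)

namespace Bar

/-- The realization of the bar construction. -/
abbrev Space : Type u := SimplicialSpace.Realization (barSimplicial X)

variable {X}

/-- The point of the realization given by a simplex and barycentric coordinates. -/
def mk {n : SimplexCategory} (y : BarSpace X n) (t : stdSimplex ℝ (Fin (n.len + 1))) : Space X :=
  Quot.mk _ ⟨n, (y, t)⟩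

theorem continuous_mk (n : SimplexCategory) :
    Continuous fun p : BarSpace X n × stdSimplex ℝ (Fin (n.len + 1)) => mk p.1 p.2 :=
  continuous_quot_mk.comp (continuous_sigmaMk (σ := fun n : SimplexCategory =>
    BarSpace X n × stdSimplex ℝ (Fin (n.len + 1))))

theorem mk_map {m n : SimplexCategory} (θ : m ⟶ n) (y : BarSpace X n)
    (t : stdSimplex ℝ (Fin (m.len + 1))) : mk (barMap X θ y) t = mk y (stdSimplex.map θ t) :=
  Quot.sound (.glue (Y := barSimplicial X) θ y t)

theorem ind {P : Space X → Prop}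
    (h : ∀ (n : SimplexCategory) (y : BarSpace X n) t, P (mk y t)) (z : Space X) : P z := by
  induction z using Quot.ind with | _ p
  exact h p.1 p.2.1 p.2.2

/-- A function on the realization. -/
def lift {W : Type*} (f : ∀ n : SimplexCategory, BarSpace X n →
      stdSimplex ℝ (Fin (n.len + 1)) → W)
    (h : ∀ (m n : SimplexCategory) (θ : m ⟶ n) (y : BarSpace X n) t,
      f m (barMap X θ y) t = f n y (stdSimplex.map θ t)) : Space X → W :=
  Quot.lift (fun p => f p.1 p.2.1 p.2.2) (by
    rintro _ _ ⟨θ, y, t⟩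
    exact h _ _ θ y t)

theorem act_mk (g : G) {n : SimplexCategory} (y : BarSpace X n)
    (t : stdSimplex ℝ (Fin (n.len + 1))) :
    (barGSpace X).act g (mk y t) = mk (barSmul X g n y) t := rfl

theorem isClosed_of_simplices {A : Set (Space X)}
    (h : ∀ (n : SimplexCategory) (p : Σ c : ComposableArrows (FinGSet G)ᵒᵖ n.len,
      ((c.obj (Fin.last n.len)).unop : Type)),
      IsClosed {q : X.obj (p.1.obj 0) × stdSimplex ℝ (Fin (n.len + 1)) | mk ⟨p, q.1⟩ q.2 ∈ A}) :
    IsClosed A := by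
  rw [← isQuotientMap_quot_mk.isClosed_preimage]
  exact isClosed_sigma_iff.2 fun n => isClosed_sigma_prod (h n)

/-- The image of `α ∈ Sₙ` in `Sᵢ`. -/
def vertex {n : SimplexCategory} (y : BarSpace X n) (i : Fin (n.len + 1)) :
    ((y.1.1.obj i).unop : Type) :=
  (y.1.1.map (homOfLE (Fin.le_last i))).unop y.1.2

theorem map_vertex {n : SimplexCategory} (y : BarSpace X n) {i j : Fin (n.len + 1)} (h : i ≤ j) :
    (y.1.1.map (homOfLE h)).unop (vertex y j) = vertex y i := by
  have h : y.1.1.map (homOfLE h) ≫ y.1.1.map (homOfLE (Fin.le_last j)) =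
      y.1.1.map (homOfLE (Fin.le_last i)) := (y.1.1.map_comp _ _).symm
  exact congrArg (fun f => f.unop y.1.2) h

theorem vertex_last {n : SimplexCategory} (y : BarSpace X n) : vertex y (Fin.last _) = y.1.2 := by
  have h : y.1.1.map (𝟙 (Fin.last _)) = 𝟙 _ := y.1.1.map_id _
  exact congrArg (fun f => f.unop y.1.2) h

theorem vertex_barMap {m n : SimplexCategory} (θ : m ⟶ n) (y : BarSpace X n)
    (i : Fin (m.len + 1)) : vertex (barMap X θ y) i = vertex y (θ i) :=
  map_vertex y (θ.toOrderHom.monotone (Fin.le_last i))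

theorem vertex_barSmul (g : G) {n : SimplexCategory} (y : BarSpace X n) (i : Fin (n.len + 1)) :
    vertex (barSmul X g n y) i = g • vertex y i :=
  FinGSet.map_smul' _ g _

/-- The element of a finite `G`-set at the last vertex of the carrier of a point. -/
noncomputable def carrier : Space X → Σ T : FinGSet G, T :=
  lift (fun _ y t => ⟨_, vertex y (stdSimplex.top t)⟩) fun m n θ y t => by
    rw [stdSimplex.top_map_hom, vertex_barMap]
    rfl

/-- The image of `α` in `Sᵢ` is fixed by the subgroup `H`. -/
def IsFixedAt (H : Subgroup G) {n : SimplexCategory} (y : BarSpace X n) (i : Fin (n.len + 1)) :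
    Prop :=
  ∀ h ∈ H, h • vertex y i = vertex y i

theorem IsFixedAt.mono {H : Subgroup G} {n : SimplexCategory} {y : BarSpace X n}
    {i j : Fin (n.len + 1)} (hj : IsFixedAt H y j) (hij : i ≤ j) : IsFixedAt H y i := by
  intro h hh
  rw [← map_vertex y hij, ← FinGSet.map_smul', hj h hh]

theorem isFixedAt_barMap {H : Subgroup G} {m n : SimplexCategory} (θ : m ⟶ n) (y : BarSpace X n)
    (i : Fin (m.len + 1)) : IsFixedAt H (barMap X θ y) i ↔ IsFixedAt H y (θ i) := by
  unfold IsFixedAt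
  rw [vertex_barMap]
  rfl

/-- The carrier is an invariant of the point, and the action changes neither the chain nor the
coordinates, so a fixed point has a fixed carrier. No nondegenerate representative is needed. -/
theorem isFixedAt_top {H : Subgroup G} {n : SimplexCategory} (y : BarSpace X n)
    (t : stdSimplex ℝ (Fin (n.len + 1))) (h : ∀ g ∈ H, (barGSpace X).act g (mk y t) = mk y t) :
    IsFixedAt H y (stdSimplex.top t) := by
  intro g hg
  have h' := congrArg carrier (h g hg)
  have h1 : carrier (mk (barSmul X g n y) t) = ⟨_, vertex (barSmul X g n y) (stdSimplex.top t)⟩ :=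
    rfl
  rw [act_mk, h1, vertex_barSmul] at h'
  exact eq_of_heq (Sigma.mk.inj h').2

end Bar

/-! ### Maps out of an orbit -/

namespace FinGSet

variable {S T : FinGSet G}

theorem exists_hom_of_fixed [MulAction.IsPretransitive G S] (s : S) (a : T)
    (h : ∀ g ∈ MulAction.stabilizer G s, g • a = a) : ∃ f : S ⟶ T, f s = a := by
  have hs : ∀ s' : S, ∃ g : G, g • s = s' := MulAction.exists_smul_eq G s
  choose g hg using hs
  -- This is well-definedness of `g • s ↦ g • a`; with it, the arbitrary choice of group elements in
  -- `hg` is harmless.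
  have hw : ∀ x y : G, x • s = y • s → x • a = y • a := fun x y hxy => by
    have := h (y⁻¹ * x) (by rw [MulAction.mem_stabilizer_iff, mul_smul, hxy, inv_smul_smul])
    rwa [mul_smul, inv_smul_eq_iff] at this
  refine ⟨⟨fun s' => g s' • a, fun x s' => ?_⟩, ?_⟩
  · change g (x • s') • a = x • g s' • a
    rw [← mul_smul]
    apply hw
    rw [hg, mul_smul, hg]
  · change g s • a = a
    rw [hw (g s) 1 (by rw [hg, one_smul]), one_smul]

theorem hom_ext_of_apply_eq [MulAction.IsPretransitive G S] (s : S) {f f' : S ⟶ T}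
    (h : f s = f' s) : f = f' := by
  refine hom_ext' fun s' => ?_
  obtain ⟨g, rfl⟩ := MulAction.exists_smul_eq G s s'
  rw [map_smul', map_smul', h]

end FinGSet

/-! ### Evaluation at a point of an orbit as a closed embedding -/

namespace Bar

variable {X} {S : FinGSet G}

/-- The map of simplices that evaluates `S ⟶ Sₙ` at a point of `S`. -/
def evalSimplex (s : S) {n : SimplexCategory} (b : HomBarSpace X (op S) n) : BarSpace X n :=
  ⟨⟨b.1.1, b.1.2.unop s⟩, b.2⟩

theorem continuous_evalSimplex (s : S) {n : SimplexCategory} :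
    Continuous (evalSimplex s : HomBarSpace X (op S) n → BarSpace X n) :=
  continuous_sigma fun p => BarSpace.continuous_mk ⟨p.1, p.2.unop s⟩

theorem evalSimplex_homBarMap (s : S) {m n : SimplexCategory} (θ : m ⟶ n)
    (b : HomBarSpace X (op S) n) :
    evalSimplex s (homBarMap X (op S) θ b) = barMap X θ (evalSimplex s b) := rfl

variable (X) in
/-- The map of realizations that evaluates `S ⟶ Sₙ` at a point of `S`. -/
def evalAt (s : S) : C(HomBar.Space X (op S), Space X) where
  toFun := HomBar.lift (fun _ b t => mk (evalSimplex s b) t) fun _ _ θ b t => by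
    rw [evalSimplex_homBarMap, mk_map]
  continuous_toFun := HomBar.continuous_lift fun n => (continuous_mk n).comp
    (((continuous_evalSimplex s).comp continuous_fst).prodMk continuous_snd)

theorem evalAt_mk (s : S) {n : SimplexCategory} (b : HomBarSpace X (op S) n)
    (t : stdSimplex ℝ (Fin (n.len + 1))) :
    evalAt X s (HomBar.mk b t) = mk (evalSimplex s b) t := rfl

theorem evalAt_smul (g : G) (s : S) (z : HomBar.Space X (op S)) :
    evalAt X (g • s) z = (barGSpace X).act g (evalAt X s z) := by
  induction z using HomBar.ind with | _ n b t
  rw [evalAt_mk, evalAt_mk, act_mk]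
  congr 1
  exact BarSpace.ext' b.1.1 (FinGSet.map_smul' _ _ _) rfl

variable (s : S)

theorem isFixedAt_evalSimplex {n : SimplexCategory} (b : HomBarSpace X (op S) n) :
    IsFixedAt (MulAction.stabilizer G s) (evalSimplex s b) (Fin.last _) := by
  intro g hg
  rw [vertex_last]
  change g • b.1.2.unop s = b.1.2.unop s
  rw [← FinGSet.map_smul', hg]

/-- `z` is obtained from `(y, t)` by truncation to an initial segment that contains the support of
`t` and over which the simplex is fixed by the stabilizer of `s`. -/
def Represents {n : SimplexCategory} (y : BarSpace X n) (t : stdSimplex ℝ (Fin (n.len + 1)))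
    (z : HomBar.Space X (op S)) : Prop :=
  ∃ k, stdSimplex.top t ≤ k ∧ ∃ b : HomBarSpace X (op S) n,
    evalSimplex s b = barMap X (n.truncate k) y ∧ z = HomBar.mk b t

variable {s}

theorem isFixedAt_of_eq {n : SimplexCategory} {y : BarSpace X n} {k : Fin (n.len + 1)}
    {b : HomBarSpace X (op S) n} (hb : evalSimplex s b = barMap X (n.truncate k) y) :
    IsFixedAt (MulAction.stabilizer G s) y k := by
  have h := isFixedAt_evalSimplex s b
  rw [hb, isFixedAt_barMap, SimplexCategory.truncate_apply, min_eq_right (Fin.le_last k)] at h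
  exact h

theorem Represents.evalAt_eq {n : SimplexCategory} {y : BarSpace X n}
    {t : stdSimplex ℝ (Fin (n.len + 1))} {z : HomBar.Space X (op S)} (h : Represents s y t z) :
    evalAt X s z = mk y t := by
  obtain ⟨k, hk, b, hb, rfl⟩ := h
  rw [evalAt_mk, hb, mk_map, stdSimplex.map_truncate hk]

variable [MulAction.IsPretransitive G S]

variable (s) in
-- An equivariant map from an orbit is determined by its value at `s`.
theorem evalSimplex_injective {n : SimplexCategory} :
    Function.Injective (evalSimplex s : HomBarSpace X (op S) n → BarSpace X n) := by
  rintro ⟨⟨c, ψ⟩, x⟩ ⟨⟨d, φ⟩, y⟩ h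
  have h1 := Sigma.mk.inj h
  obtain ⟨rfl, h2⟩ := Sigma.mk.inj h1.1
  have h3 : ψ = φ := Quiver.Hom.unop_inj (FinGSet.hom_ext_of_apply_eq s (eq_of_heq h2))
  exact HomBarSpace.ext' h3 (eq_of_heq h1.2)

variable (s) in
theorem exists_evalSimplex {n : SimplexCategory} (y : BarSpace X n)
    (h : IsFixedAt (MulAction.stabilizer G s) y (Fin.last _)) :
    ∃ b : HomBarSpace X (op S) n, evalSimplex s b = y := by
  unfold IsFixedAt at h
  rw [vertex_last] at h
  obtain ⟨f, hf⟩ := FinGSet.exists_hom_of_fixed s y.1.2 h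
  exact ⟨⟨⟨y.1.1, f.op⟩, y.2⟩, BarSpace.ext' y.1.1 hf rfl⟩

/-- Of two admissible truncations the shorter is a truncation of the longer, by an operator that
fixes `t`; the lifted simplices are therefore glued together at `t`. -/
theorem Represents.unique {n : SimplexCategory} {y : BarSpace X n}
    {t : stdSimplex ℝ (Fin (n.len + 1))} {z z' : HomBar.Space X (op S)} (h : Represents s y t z)
    (h' : Represents s y t z') : z = z' := by
  obtain ⟨k, hk, b, hb, rfl⟩ := h
  obtain ⟨k', hk', b', hb', rfl⟩ := h'
  wlog hkk : k ≤ k' generalizing k k' b b'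
  · exact (this k' hk' b' hb' k hk b hb (le_of_not_ge hkk)).symm
  have ht : n.truncate k ≫ n.truncate k' = n.truncate k := by
    ext i : 3
    exact min_eq_left ((min_le_right i k).trans hkk)
  have h : b = homBarMap X (op S) (n.truncate k) b' := by
    apply evalSimplex_injective s
    rw [evalSimplex_homBarMap, hb, hb', ← barMap_comp, ht]
  rw [h, HomBar.mk_map, stdSimplex.map_truncate hk]

theorem exists_represents {n : SimplexCategory} {y : BarSpace X n}
    {t : stdSimplex ℝ (Fin (n.len + 1))} {k : Fin (n.len + 1)} (hk : stdSimplex.top t ≤ k)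
    (h : IsFixedAt (MulAction.stabilizer G s) y k) :
    ∃ b : HomBarSpace X (op S) n, evalSimplex s b = barMap X (n.truncate k) y ∧
      Represents s y t (HomBar.mk b t) := by
  obtain ⟨b, hb⟩ := exists_evalSimplex s (barMap X (n.truncate k) y)
    ((isFixedAt_barMap _ _ _).2 (h.mono (min_le_right _ _)))
  exact ⟨b, hb, k, hk, b, hb, rfl⟩

/-- Truncating `y` at `θ k` matches truncating `barMap X θ y` at `k`, and injectivity of
`evalSimplex` lifts this relation to the represented bar construction. -/
theorem Represents.map {m n : SimplexCategory} {θ : m ⟶ n} {y : BarSpace X n}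
    {t : stdSimplex ℝ (Fin (m.len + 1))} {z : HomBar.Space X (op S)}
    (h : Represents s (barMap X θ y) t z) : Represents s y (stdSimplex.map θ t) z := by
  obtain ⟨k, hk, b, hb, rfl⟩ := h
  have hθ : stdSimplex.top (stdSimplex.map θ t) ≤ θ k := by
    rw [stdSimplex.top_map_hom]
    exact θ.toOrderHom.monotone hk
  obtain ⟨b', hb', h'⟩ := exists_represents (t := stdSimplex.map θ t) hθ
    ((isFixedAt_barMap _ _ _).1 (isFixedAt_of_eq hb))
  have hc : m.truncate k ≫ θ ≫ n.truncate (θ k) = m.truncate k ≫ θ := by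
    ext i : 3
    exact min_eq_left (θ.toOrderHom.monotone (min_le_right i k))
  have h : b = homBarMap X (op S) (m.truncate k ≫ θ) b' := by
    apply evalSimplex_injective s
    rw [evalSimplex_homBarMap, hb, hb', ← barMap_comp, ← barMap_comp, Category.assoc, hc]
  rwa [h, homBarMap_comp, HomBar.mk_map, stdSimplex.map_truncate hk, HomBar.mk_map]

theorem represents_map_iff {m n : SimplexCategory} (θ : m ⟶ n) (y : BarSpace X n)
    (t : stdSimplex ℝ (Fin (m.len + 1))) (z : HomBar.Space X (op S)) :
    Represents s (barMap X θ y) t z ↔ Represents s y (stdSimplex.map θ t) z := by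
  refine ⟨Represents.map, fun h => ?_⟩
  obtain ⟨k, hk, b, hb, -⟩ := id h
  rw [stdSimplex.top_map_hom] at hk
  -- Fixedness at `k` passes down to `θ (top t)`, so `(barMap X θ y, t)` represents some point;
  -- pushing it forward and using uniqueness shows that this point is `z`.
  obtain ⟨b', -, h'⟩ := exists_represents (s := s) (y := barMap X θ y) (t := t) le_rfl
    ((isFixedAt_barMap _ _ _).2 ((isFixedAt_of_eq hb).mono hk))
  rwa [h.unique h'.map]

variable (s) in
/-- The relation `Represents` on points of the realization. -/
def RepresentsPoint (w : Space X) : HomBar.Space X (op S) → Prop :=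
  lift (fun _ y t => Represents s y t) (fun _ _ θ y t => funext fun z =>
    propext (represents_map_iff θ y t z)) w

theorem representsPoint_evalAt (z : HomBar.Space X (op S)) :
    RepresentsPoint s (evalAt X s z) z := by
  induction z using HomBar.ind with | _ n b t
  have h : n.truncate (Fin.last _) = 𝟙 n := by
    ext i : 3
    exact min_eq_left (Fin.le_last i)
  exact ⟨Fin.last _, Fin.le_last _, b, by rw [h, barMap_id], rfl⟩

variable (X s) in
-- Both points are represented by their common image, where `Represents.unique` applies to any
-- representative.
theorem evalAt_injective : Function.Injective (evalAt X s) := by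
  intro z z' h
  have h1 := representsPoint_evalAt (s := s) z
  have h2 := representsPoint_evalAt (s := s) z'
  rw [← h] at h2
  generalize evalAt X s z = w at h1 h2
  induction w using ind with | _ n y t
  exact Represents.unique (n := n) h1 h2

variable (X s) in
-- On each simplex the preimage of the image of `A` is a finite union over truncation levels. Each
-- piece is empty, or is a closed face intersected with the preimage of `A` under a continuous lift.
theorem isClosedMap_evalAt : IsClosedMap (evalAt X s) := by
  intro A hA
  refine isClosed_of_simplices fun n p => ?_
  have h : {q : X.obj (p.1.obj 0) × stdSimplex ℝ (Fin (n.len + 1)) |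
      mk ⟨p, q.1⟩ q.2 ∈ evalAt X s '' A} =
    ⋃ k, {q | stdSimplex.top q.2 ≤ k ∧ ∃ b : HomBarSpace X (op S) n,
      evalSimplex s b = barMap X (n.truncate k) ⟨p, q.1⟩ ∧ HomBar.mk b q.2 ∈ A} := by
    ext q
    rw [Set.mem_iUnion]
    constructor
    · rintro ⟨z, hz, hq⟩
      have h := representsPoint_evalAt (s := s) z
      rw [hq] at h
      obtain ⟨k, hk, b, hb, rfl⟩ := h
      exact ⟨k, hk, b, hb, hz⟩
    · rintro ⟨k, hk, b, hb, hA⟩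
      exact ⟨_, hA, Represents.evalAt_eq ⟨k, hk, b, hb, rfl⟩⟩
  rw [h]
  refine isClosed_iUnion_of_finite fun k => ?_
  let c := p.1.whiskerLeft (SimplexCategory.toCat.map (n.truncate k)).toFunctor
  let α : (c.obj (Fin.last n.len)).unop :=
    (p.1.map (homOfLE (Fin.le_last (n.truncate k (Fin.last n.len))))).unop p.2
  -- Whether the truncated simplex lifts depends only on the chain and `α`, not on the point of
  -- `𝒳(S₀)`, so one map `f` serves for the whole summand.
  by_cases hf : ∃ f : S ⟶ (c.obj (Fin.last n.len)).unop, f s = α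
  · obtain ⟨f, hf⟩ := hf
    let a (x : X.obj (p.1.obj 0)) : HomBarSpace X (op S) n :=
      ⟨⟨c, f.op⟩, X.map (p.1.map (homOfLE (Fin.zero_le (n.truncate k 0)))) x⟩
    have ha : Continuous a := (HomBarSpace.continuous_mk (X := X) ⟨c, f.op⟩).comp
      (X.map (p.1.map (homOfLE (Fin.zero_le (n.truncate k 0))))).hom.hom.continuous
    have hb : ∀ x, evalSimplex s (a x) = barMap X (n.truncate k) ⟨p, x⟩ := fun x =>
      BarSpace.ext' c hf rfl
    have h' : {q : X.obj (p.1.obj 0) × stdSimplex ℝ (Fin (n.len + 1)) | stdSimplex.top q.2 ≤ k ∧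
        ∃ b : HomBarSpace X (op S) n,
          evalSimplex s b = barMap X (n.truncate k) ⟨p, q.1⟩ ∧ HomBar.mk b q.2 ∈ A} =
        {q | stdSimplex.top q.2 ≤ k} ∩ {q | HomBar.mk (a q.1) q.2 ∈ A} := by
      ext q
      refine and_congr_right fun _ => ⟨?_, fun h => ⟨_, hb _, h⟩⟩
      rintro ⟨b, hb', hA⟩
      rw [← hb] at hb'
      rwa [evalSimplex_injective s hb'] at hA
    rw [h']
    exact ((stdSimplex.isClosed_top_le k).preimage continuous_snd).inter
      (hA.preimage ((HomBar.continuous_mk n).comp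
        ((ha.comp continuous_fst).prodMk continuous_snd)))
  · convert! isClosed_empty
    refine Set.eq_empty_of_forall_notMem ?_
    rintro q ⟨-, ⟨⟨d, ψ⟩, x⟩, hb, -⟩
    have h1 := (Sigma.mk.inj hb).1
    obtain ⟨rfl, h2⟩ := Sigma.mk.inj h1
    exact hf ⟨ψ.unop, eq_of_heq h2⟩

variable (X s) in
theorem isClosedEmbedding_evalAt : IsClosedEmbedding (evalAt X s) :=
  .of_continuous_injective_isClosedMap (evalAt X s).continuous (evalAt_injective X s)
    (isClosedMap_evalAt X s)

theorem mem_range_evalAt {w : Space X}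
    (h : ∀ g ∈ MulAction.stabilizer G s, (barGSpace X).act g w = w) :
    w ∈ Set.range (evalAt X s) := by
  induction w using ind with | _ n y t
  obtain ⟨b, -, h'⟩ := exists_represents le_rfl (isFixedAt_top y t h)
  exact ⟨_, h'.evalAt_eq⟩

end Bar

/-! ### Equivariant maps from an orbit as a represented bar construction -/

namespace Bar

variable (S : FinGSet G)

/-- The comparison of `|B_•(X, G𝓕, Hom(S, -))|` with the equivariant maps from `S` to the
realization. -/
def toFixed : C(HomBar.Space X (op S), Kify (EquivariantMap S (barGSpace X))) where
  toFun z := ⟨⟨fun s => evalAt X s z, fun g s => evalAt_smul g s z⟩⟩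
  continuous_toFun := Kify.continuous_mk
    (Continuous.subtype_mk (continuous_pi fun s => (evalAt X s).continuous) _)

variable {X S}

/-- Evaluation of equivariant maps at a point. -/
def evalFixed (s : S) : C(Kify (EquivariantMap S (barGSpace X)), Space X) where
  toFun f := EquivariantMap.eval f s
  continuous_toFun :=
    (continuous_apply s).comp (continuous_subtype_val.comp Kify.continuous_val)

variable (X S)

theorem bijective_toFixed [MulAction.IsPretransitive G S] [Nonempty S] :
    Function.Bijective (toFixed X S) := by
  obtain ⟨s⟩ := ‹Nonempty S›
  constructor
  · intro z z' h
    exact evalAt_injective X s (congrArg (evalFixed s) h)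
  · intro f
    obtain ⟨z, hz⟩ := mem_range_evalAt (s := s) (w := EquivariantMap.eval f s) fun g hg => by
      rw [EquivariantMap.eval, ← f.val.2, hg]
    refine ⟨z, Kify.ext (Subtype.ext (funext fun s' => ?_))⟩
    obtain ⟨g, rfl⟩ := MulAction.exists_smul_eq G s s'
    refine (evalAt_smul g s z).trans ?_
    rw [hz]
    exact (f.val.2 g s).symm

/-- Evaluation at `s` composed with `toFixed` is the embedding `evalAt X s`, which forces `toFixed`
to be inducing. The compactly generated topology on the mapping space enters only through continuity
of the two maps. -/
theorem isHomeomorph_toFixed [MulAction.IsPretransitive G S] [Nonempty S] :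
    IsHomeomorph (toFixed X S) := by
  have hb := bijective_toFixed X S
  obtain ⟨s⟩ := ‹Nonempty S›
  rw [isHomeomorph_iff_isEmbedding_surjective]
  refine ⟨⟨?_, hb.1⟩, hb.2⟩
  exact .of_comp (toFixed X S).continuous (evalFixed s).continuous
    (isClosedEmbedding_evalAt X s).isInducing

/-- Equivariant maps from an orbit `S` to the realization are points of
`|B_•(X, G𝓕, Hom(S, -))|`. -/
noncomputable def fixedHomeomorph [MulAction.IsPretransitive G S] [Nonempty S] :
    HomBar.Space X (op S) ≃ₜ Kify (EquivariantMap S (barGSpace X)) :=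
  (isHomeomorph_toFixed X S).homeomorph

end Bar

end FixedPoints

/-! ### Decomposition into orbits -/

section Orbits

variable {G : Type u} [Group G]

theorem FinGSet.exists_orbit_decomposition (S : FinGSet G) :
    ∃ (J : Type) (_ : Finite J) (O : J → FinGSet G) (ι : ∀ j, O j ⟶ S),
      (∀ j, MulAction.IsPretransitive G (O j)) ∧ (∀ j, Nonempty (O j)) ∧
      Function.Bijective fun p : Σ j, (O j : Type) => ι p.1 p.2 := by
  have h : ∀ j : MulAction.orbitRel.Quotient G S, ∃ (O : FinGSet G) (e : O ≃ j.orbit),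
      ∀ (g : G) (s : O), e (g • s) = g • e s := fun j => exists_equiv j.orbit
  choose O e he using h
  refine ⟨MulAction.orbitRel.Quotient G S, inferInstance, O,
    fun j => ⟨fun s => (e j s : S), fun g s => ?_⟩, fun j => ⟨fun a b => ?_⟩, fun j => ?_, ?_, ?_⟩
  · exact congrArg Subtype.val (he j g s)
  · obtain ⟨g, hg⟩ := MulAction.exists_smul_eq G (e j a) (e j b)
    exact ⟨g, (e j).injective (by rw [he, hg])⟩
  · obtain ⟨s, hs⟩ := j.nonempty_orbit
    exact ⟨(e j).symm ⟨s, hs⟩⟩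
  · rintro ⟨j, a⟩ ⟨k, b⟩ h
    have h' : (e j a : S) = (e k b : S) := h
    have h1 := MulAction.orbitRel.Quotient.mem_orbit.1 (e j a).2
    have h2 := MulAction.orbitRel.Quotient.mem_orbit.1 (e k b).2
    rw [h', h2] at h1
    subst h1
    rw [(e k).injective (Subtype.ext h')]
  · intro s
    exact ⟨⟨Quotient.mk'' s, (e _).symm ⟨s, MulAction.orbitRel.Quotient.mem_orbit.2 rfl⟩⟩,
      congrArg Subtype.val ((e _).apply_symm_apply _)⟩

variable {S : FinGSet G} {J : Type} {O : J → FinGSet G} {ι : ∀ j, O j ⟶ S}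

theorem FinGSet.exists_fac_of_orbit (hι : Function.Bijective fun p : Σ j, (O j : Type) => ι p.1 p.2)
    {T : FinGSet G} [MulAction.IsPretransitive G T] [Nonempty T] (f : T ⟶ S) :
    ∃ (j : J) (k : T ⟶ O j), f = k ≫ ι j := by
  obtain ⟨t⟩ := ‹Nonempty T›
  obtain ⟨⟨j, a⟩, ha⟩ := hι.2 (f t)
  -- The stabilizer of `t` fixes `f t`, hence fixes `a` by injectivity of the decomposition; so `t ↦
  -- a` extends to an equivariant map.
  obtain ⟨k, hk⟩ := exists_hom_of_fixed t a fun g hg => by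
    have h : (⟨j, g • a⟩ : Σ j, (O j : Type)) = ⟨j, a⟩ := by
      apply hι.1
      change ι j (g • a) = ι j a
      rw [map_smul']
      have ha' : ι j a = f t := ha
      rw [ha', ← map_smul', hg]
    exact eq_of_heq (Sigma.mk.inj h).2
  refine ⟨j, k, hom_ext_of_apply_eq t ?_⟩
  rw [comp_apply, hk]
  exact ha.symm

/-- A disjoint union decomposition is a product decomposition in the opposite category. -/
noncomputable def FinGSet.isLimitFan
    (hι : Function.Bijective fun p : Σ j, (O j : Type) => ι p.1 p.2) :
    IsLimit (Fan.mk (op S) fun j => (ι j).op) := by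
  let e := Equiv.ofBijective _ hι
  have he : ∀ j a, e.symm (ι j a) = ⟨j, a⟩ := fun j a => e.symm_apply_apply ⟨j, a⟩
  have hs : ∀ (g : G) j a, e.symm (g • ι j a) = ⟨j, g • a⟩ := fun g j a => by
    rw [← map_smul', he]
  refine Fan.IsLimit.mk _ (fun t => Quiver.Hom.op (Y := t.pt.unop)
    ⟨fun s => (t.proj (e.symm s).1).unop (e.symm s).2, fun g s => ?_⟩) ?_ ?_
  · obtain ⟨⟨j, a⟩, rfl⟩ := e.surjective s
    change (t.proj (e.symm (g • ι j a)).1).unop (e.symm (g • ι j a)).2 =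
      g • (t.proj (e.symm (ι j a)).1).unop (e.symm (ι j a)).2
    rw [hs, he]
    exact map_smul' _ g a
  · intro t j
    refine Quiver.Hom.unop_inj (hom_ext' fun a => ?_)
    change (t.proj (e.symm (ι j a)).1).unop (e.symm (ι j a)).2 = (t.proj j).unop a
    rw [he]
  · intro t m hm
    refine Quiver.Hom.unop_inj (hom_ext' fun s => ?_)
    obtain ⟨⟨j, a⟩, rfl⟩ := e.surjective s
    change m.unop (ι j a) = (t.proj (e.symm (ι j a)).1).unop (e.symm (ι j a)).2
    rw [he, ← hm j]
    rfl

variable {F : (FinGSet G)ᵒᵖ ⥤ CompactlyGenerated.{u, u}}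

/-- The product here is the categorical one, so `Y` must itself be compactly generated for the
universal property to apply. -/
theorem isGSystem.exists_lift (hF : isGSystem G F) [Finite J]
    (hι : Function.Bijective fun p : Σ j, (O j : Type) => ι p.1 p.2)
    {Y : Type u} [TopologicalSpace Y] [UCompactlyGeneratedSpace.{u} Y]
    (l : ∀ j, C(Y, F.obj (op (O j)))) :
    ∃ m : C(Y, F.obj (op S)), ∀ j y, F.map (ι j).op (m y) = l j y := by
  have : PreservesFiniteProducts F := hF
  have h := isLimitFanMkObjOfIsLimit F _ _ (FinGSet.isLimitFan hι)
  let l' (j : J) : CompactlyGenerated.of Y ⟶ F.obj (op (O j)) := ConcreteCategory.ofHom (l j)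
  exact ⟨(Fan.IsLimit.lift h l').hom.hom,
    fun j y => ConcreteCategory.congr_hom (Fan.IsLimit.fac h l' j) y⟩

theorem isGSystem.ext (hF : isGSystem G F) [Finite J]
    (hι : Function.Bijective fun p : Σ j, (O j : Type) => ι p.1 p.2) {x y : F.obj (op S)}
    (hxy : ∀ j, F.map (ι j).op x = F.map (ι j).op y) : x = y := by
  have : PreservesFiniteProducts F := hF
  have h := isLimitFanMkObjOfIsLimit F _ _ (FinGSet.isLimitFan hι)
  -- Points are treated as maps from a one-point space, to which uniqueness in the universal
  -- property applies.
  let c (x : F.obj (op S)) : CompactlyGenerated.of PUnit.{u + 1} ⟶ F.obj (op S) :=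
    ConcreteCategory.ofHom (ContinuousMap.const _ x)
  have hc : c x = c y := Fan.IsLimit.hom_ext h _ _ fun j => by
    ext
    exact hxy j
  exact ConcreteCategory.congr_hom hc PUnit.unit

end Orbits

/-! ### The comparison map -/

section Comparison

variable {G : Type u} [Group G] (X : (FinGSet G)ᵒᵖ ⥤ CompactlyGenerated.{u, u})

namespace Bar

/-- The fixed point system of the bar construction. -/
abbrev fixed : (FinGSet G)ᵒᵖ ⥤ CompactlyGenerated.{u, u} := fixedPointFunctor (barGSpace X)

/-! ### The comparison map at a single orbit -/

section Orbit

variable (S T : FinGSet G) [MulAction.IsPretransitive G S] [Nonempty S]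
  [MulAction.IsPretransitive G T] [Nonempty T]

/-- The comparison map at an orbit. -/
noncomputable def orbitCounit : C((fixed X).obj (op S), X.obj (op S)) :=
  (HomBar.augmentation X (op S)).comp
    ⟨(fixedHomeomorph X S).symm, (fixedHomeomorph X S).symm.continuous⟩

theorem orbitCounit_toFixed (z : HomBar.Space X (op S)) :
    orbitCounit X S (toFixed X S z) = HomBar.augmentation X (op S) z :=
  congrArg (HomBar.augmentation X (op S)) ((fixedHomeomorph X S).symm_apply_apply z)

theorem exists_orbit_deformation :
    ∃ (i : C(X.obj (op S), (fixed X).obj (op S)))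
      (K : C((fixed X).obj (op S) × unitInterval, (fixed X).obj (op S))),
      (∀ x, orbitCounit X S (i x) = x) ∧ (∀ z, K (z, 0) = z) ∧
      (∀ z, K (z, 1) = i (orbitCounit X S z)) ∧
      (∀ z u, orbitCounit X S (K (z, u)) = orbitCounit X S z) ∧ ∀ x u, K (i x, u) = i x := by
  let e := fixedHomeomorph X S
  have he : ∀ z, e.symm (toFixed X S z) = z := e.symm_apply_apply
  have he' : ∀ z, toFixed X S (e.symm z) = z := e.apply_symm_apply
  refine ⟨(toFixed X S).comp (HomBar.inclusion X (op S)),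
    ⟨fun p => toFixed X S (HomBar.deformation X (op S) (e.symm p.1, p.2)), ?_⟩,
    fun x => ?_, fun z => ?_, fun z => ?_, fun z u => ?_, fun x u => ?_⟩
  · exact (toFixed X S).continuous.comp ((HomBar.deformation X (op S)).continuous.comp
      ((e.symm.continuous.comp continuous_fst).prodMk continuous_snd))
  · exact (orbitCounit_toFixed X S _).trans (HomBar.augmentation_inclusion x)
  · exact (congrArg (toFixed X S) (HomBar.deformation_zero (e.symm z))).trans (he' z)
  · exact congrArg (toFixed X S) (HomBar.deformation_one (e.symm z))
  · exact (orbitCounit_toFixed X S _).trans (HomBar.augmentation_deformation _ u)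
  · change toFixed X S (HomBar.deformation X (op S) (e.symm (toFixed X S _), u)) = _
    rw [he, HomBar.deformation_inclusion]
    rfl

variable {S T}

theorem orbitCounit_map (h : S ⟶ T) (z : (fixed X).obj (op T)) :
    orbitCounit X S ((fixed X).map h.op z) = X.map h.op (orbitCounit X T z) := by
  obtain ⟨w, rfl⟩ := (bijective_toFixed X T).2 z
  rw [orbitCounit_toFixed]
  induction w using HomBar.ind with | _ n b t
  -- Restriction along `h` only precomposes the map `T ⟶ Sₙ` with `h`; the augmentation turns this
  -- into application of `X.map h.op`.
  let b' : HomBarSpace X (op S) n := ⟨⟨b.1.1, b.1.2 ≫ h.op⟩, b.2⟩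
  have hb : (fixed X).map h.op (toFixed X T (HomBar.mk b t)) = toFixed X S (HomBar.mk b' t) := rfl
  rw [hb, orbitCounit_toFixed]
  change X.map (_ ≫ b.1.2 ≫ h.op) b.2 = X.map h.op (X.map (_ ≫ b.1.2) b.2)
  rw [← Category.assoc, X.map_comp]
  rfl

variable {X} (S)

/-- The map of bar constructions induced by a map of functors. -/
abbrev barGSpaceMap {Y : (FinGSet G)ᵒᵖ ⥤ CompactlyGenerated.{u, u}} (f : X ⟶ Y) :
    barGSpace X ⟶ barGSpace Y :=
  (geometricRealization.mapAction G).map { hom := barSimplicialMap f, comm := fun _ => rfl }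

theorem orbitCounit_naturality {Y : (FinGSet G)ᵒᵖ ⥤ CompactlyGenerated.{u, u}} (f : X ⟶ Y)
    (z : (fixed X).obj (op S)) :
    orbitCounit Y S (EquivariantMap.map (𝟙 S) (barGSpaceMap f) z) =
      f.app (op S) (orbitCounit X S z) := by
  obtain ⟨w, rfl⟩ := (bijective_toFixed X S).2 z
  rw [orbitCounit_toFixed]
  induction w using HomBar.ind with | _ n b t
  let b' : HomBarSpace Y (op S) n := ⟨b.1, f.app _ b.2⟩
  have hb : EquivariantMap.map (𝟙 S) (barGSpaceMap f) (toFixed X S (HomBar.mk b t)) =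
    toFixed Y S (HomBar.mk b' t) := rfl
  rw [hb, orbitCounit_toFixed]
  exact (ConcreteCategory.congr_hom (f.naturality _) b.2).symm

end Orbit

/-! ### The comparison map at all finite `G`-sets -/

variable {X}

/-- Every map from an orbit factors through one of the chosen summands, so the formula on summands
extends to all maps from orbits. In this form it does not mention the decomposition, which makes
naturality and the value at an orbit immediate. -/
theorem exists_counit (hX : isGSystem G X) (S : FinGSet G) :
    ∃ e : C((fixed X).obj (op S), X.obj (op S)),
      ∀ (T : FinGSet G) [MulAction.IsPretransitive G T] [Nonempty T] (f : T ⟶ S) z,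
        X.map f.op (e z) = orbitCounit X T ((fixed X).map f.op z) := by
  obtain ⟨J, _, O, ι, _, _, hι⟩ := S.exists_orbit_decomposition
  obtain ⟨e, he⟩ := hX.exists_lift hι (Y := (fixed X).obj (op S)) fun j =>
    (orbitCounit X (O j)).comp ((fixed X).map (ι j).op).hom.hom
  refine ⟨e, fun T _ _ f z => ?_⟩
  obtain ⟨j, k, rfl⟩ := FinGSet.exists_fac_of_orbit hι f
  rw [op_comp, X.map_comp, (fixed X).map_comp]
  refine (congrArg (X.map k.op) (he j z)).trans ?_
  exact (orbitCounit_map X k _).symm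

/-- The comparison map at a finite `G`-set, determined by its restriction to orbits. -/
noncomputable def counit (hX : isGSystem G X) (S : FinGSet G) :
    C((fixed X).obj (op S), X.obj (op S)) :=
  (exists_counit hX S).choose

theorem map_counit (hX : isGSystem G X) {S T : FinGSet G} [MulAction.IsPretransitive G T]
    [Nonempty T] (f : T ⟶ S) (z : (fixed X).obj (op S)) :
    X.map f.op (counit hX S z) = orbitCounit X T ((fixed X).map f.op z) :=
  (exists_counit hX S).choose_spec T f z

theorem counit_eq_orbitCounit (hX : isGSystem G X) (S : FinGSet G)
    [MulAction.IsPretransitive G S] [Nonempty S] : counit hX S = orbitCounit X S := by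
  ext z
  have h := map_counit hX (𝟙 S) z
  rw [op_id, X.map_id, (fixed X).map_id] at h
  exact h

theorem counit_map (hX : isGSystem G X) {S T : FinGSet G} (h : S ⟶ T)
    (z : (fixed X).obj (op T)) :
    counit hX S ((fixed X).map h.op z) = X.map h.op (counit hX T z) := by
  obtain ⟨J, _, O, ι, _, _, hι⟩ := S.exists_orbit_decomposition
  refine hX.ext hι fun j => ?_
  have h1 := map_counit hX (ι j ≫ h) z
  rw [op_comp, X.map_comp, (fixed X).map_comp] at h1
  exact (map_counit hX (ι j) _).trans h1.symm

theorem counit_naturality {Y : (FinGSet G)ᵒᵖ ⥤ CompactlyGenerated.{u, u}} (hX : isGSystem G X)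
    (hY : isGSystem G Y) (f : X ⟶ Y) (S : FinGSet G) (z : (fixed X).obj (op S)) :
    counit hY S (EquivariantMap.map (𝟙 S) (barGSpaceMap f) z) =
      f.app (op S) (counit hX S z) := by
  obtain ⟨J, _, O, ι, _, _, hι⟩ := S.exists_orbit_decomposition
  refine hY.ext hι fun j => ?_
  refine (map_counit hY (ι j) _).trans ?_
  refine (orbitCounit_naturality (O j) f ((fixed X).map (ι j).op z)).trans ?_
  rw [← map_counit hX]
  exact ConcreteCategory.congr_hom (f.naturality (ι j).op) (counit hX S z)

theorem counit_isFiberDeformation (hX : isGSystem G X) (S : FinGSet G) :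
    (counit hX S).IsFiberDeformation := by
  obtain ⟨J, _, O, ι, _, _, hι⟩ := S.exists_orbit_decomposition
  have hΦ : isGSystem G (fixed X) := fixedPointFunctor_isGSystem _
  choose i K hi hK0 hK1 hKr _ using fun j => exists_orbit_deformation X (O j)
  obtain ⟨i', hi'⟩ := hΦ.exists_lift hι (Y := X.obj (op S)) fun j =>
    (i j).comp (X.map (ι j).op).hom.hom
  -- The orbitwise homotopies all share the time parameter and form a homotopy into the product; the
  -- product of a compactly generated space with the interval is again compactly generated.
  obtain ⟨K', hK'⟩ := hΦ.exists_lift hι (Y := (fixed X).obj (op S) × unitInterval) fun j =>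
    (K j).comp (((fixed X).map (ι j).op).hom.hom.prodMap (ContinuousMap.id _))
  refine ⟨i', K', fun x => hX.ext hι fun j => ?_, fun z => hΦ.ext hι fun j => ?_,
    fun z => hΦ.ext hι fun j => ?_, fun z u => hX.ext hι fun j => ?_⟩
  · rw [map_counit, hi']
    exact hi j _
  · rw [hK']
    exact hK0 j _
  · rw [hK', hi']
    refine (hK1 j _).trans (congrArg (i j) ?_)
    exact (map_counit hX (ι j) z).symm
  · rw [map_counit, hK', map_counit]
    exact hKr j _ _

theorem counit_isStrongDeformationRetraction (hX : isGSystem G X) (S : FinGSet G)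
    [MulAction.IsPretransitive G S] [Nonempty S] :
    (counit hX S).IsStrongDeformationRetraction := by
  rw [counit_eq_orbitCounit]
  obtain ⟨i, K, hi, hK0, hK1, -, hKi⟩ := exists_orbit_deformation X S
  -- The deformation starts at the identity, whereas the required homotopy ends there.
  refine ⟨i, ContinuousMap.ext hi, ContinuousMap.HomotopicRel.symm
    ⟨⟨⟨K.comp ContinuousMap.prodSwap, hK0, hK1⟩, ?_⟩⟩⟩
  rintro u _ ⟨x, rfl⟩
  exact hKi x u

end Bar

/-- The natural transformation `ε : ΦΨ ⟶ 𝟭`. -/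
noncomputable def psiPhiCounit (G : Type u) [Group G] : Psi G ⋙ Phi G ⟶ 𝟭 (GSystem G) where
  app X := ObjectProperty.homMk
    { app := fun S => ConcreteCategory.ofHom (Bar.counit X.property S.unop)
      naturality := fun _ _ h => ConcreteCategory.hom_ext _ _ fun z =>
        Bar.counit_map X.property h.unop z }
  naturality X Y f := by
    apply ObjectProperty.hom_ext
    ext S z
    exact Bar.counit_naturality X.property Y.property f.hom S.unop z

end Comparison

/-! ### The main theorem -/

theorem mainTheorem7 (G : Type u) [Group G] [Finite G] :
    ∃ ε : Psi G ⋙ Phi G ⟶ 𝟭 (GSystem G),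
      (∀ X : GSystem G, GSystem.IsWeakEquiv (ε.app X)) ∧
      (∀ (X : GSystem G) (S : FinGSet G), Nonempty S → MulAction.IsPretransitive G S →
        (GSystem.component (ε.app X) S).IsStrongDeformationRetraction) ∧
      (∀ (X Y : GSystem G) (f : X ⟶ Y),
        GSystem.IsWeakEquiv f → GSpace.IsWeakEquiv ((Psi G).map f)) := by
  have hε : ∀ X : GSystem G, GSystem.IsWeakEquiv ((psiPhiCounit G).app X) := fun X S =>
    (Bar.counit_isFiberDeformation X.property S).isWeakHomotopyEquiv
  refine ⟨psiPhiCounit G, hε, fun X S _ _ =>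
    Bar.counit_isStrongDeformationRetraction X.property S, fun X Y f hf S => ?_⟩
  have h := (psiPhiCounit G).naturality f
  -- The naturality square equates `ε_Y ∘ ΦΨf` with `f ∘ ε_X`, a composite of weak equivalences;
  -- cancelling `ε_Y` on the left leaves `ΦΨf`.
  refine ContinuousMap.IsWeakHomotopyEquiv.of_comp (hε Y S) ?_
  convert! (hf S).comp (hε X S) using 1
  exact congrArg (GSystem.component · S) h
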